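/- **Conventions.** A ball whose boundary sphere is decorated by $m$ disjoint circles has partition function $\sqrt2^{\,m}$. For two neighbouring strings, a wire (a pair of charges) joining two vertical strings $\|$ stands for $\sqrt2\,\asymp-\|$, where $\asymp$ is a cap over a cup, and a wire joining the two arcs of $\asymp$ stands for $\sqrt2\,\|-\asymp$. The crossing with parameter $\alpha$ (written in its left or right region) stands for $\frac1{\sqrt2}\asymp+\frac{\alpha}{\sqrt2}(\asymp\text{ with wire})=\alpha\,\|+\frac{1-\alpha}{\sqrt2}\asymp$. Partition functions are extended multilinearly. A disc with four marked boundary points carries a qubit with orthonormal basis $|0\rangle_X$ ($\frac1{\sqrt2}$ times two nested arcs) and $|1\rangle_X$ ($\frac1{\sqrt2}$ times two nested arcs joined by a wire). The partition function $Z$ of a handlebody glued from decorated balls along such discs is obtained by cutting all these discs, i.e. summing over the basis vectors of all discs the product of the partition functions of the balls capped by these basis vectors. **Standard forms.** Consider the following balls, with 1, 2, 2, 3 discs: (i) *the cap*, decorated by two nested arcs; (ii) *$X$*, four parallel strings with a pair of charges on the first two; (iii) *the crossing cylinder* with parameter $\alpha\in\mathbb C\setminus\{0\}$, two outer parallel strings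 with two strings between them crossing with parameter $\alpha$ (written towards the outer strings); (iv) *$w$*, three discs in cyclic order, neighbouring discs joined by an outer string, and three inner strings, one from each disc to the next, crossing pairwise with parameter $e^{i\pi/3}$, the crossing $j$ lying next to the outer string between discs $j$ and $j+1$ with its parameter written towards it. A *standard-form genus-zero 2d-CDM* $\widehat G$ is a finite handlebody glued, with planar (genus-zero) gluing pattern, from pieces (i), (ii), (iv) by joining their discs in pairs through chains of finitely many (possibly zero) crossing cylinders (iii). **Dictionary.** $\mathfrak F$ sends $\widehat G$ to the following weighted multigraph $\Gamma=\mathfrak F(\widehat G)$ with a global coefficient $c$. The cap becomes $\sqrt2$ times a vertex of degree 1, $X$ a vertex of degree 2, $w$ becomes $\frac{\sqrt3}2 i$ times a vertex of degree 3, and a crossing with parameter $\alpha$ becomes $\alpha$ times an edge of weight $1/\alpha$. Thus the vertices of $\Gamma$ are the pieces (i), (ii), (iv); its edges are the chains, and a chain with parameters $\alpha_1,\dots,\alpha_n$ has weight $\prod_k\alpha_k^{-1}$ (1 if the chain is empty); $c$ is the product of all the scalars. Put $$\operatorname{PM}(\Gamma)=c\sum_{M}\prod_{e\in M}w(e),$$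 the sum being over the perfect matchings $M$ of $\Gamma$. **Proposition.** For every standard-form genus-zero 2d-CDM $\widehat G$, the multigraph $\Gamma=\mathfrak F(\widehat G)$ is planar, all its vertices have degree at most 3, and $$\operatorname{PM}(\Gamma)=Z(\widehat G).$$ Moreover, for every numbering of the vertices, $\Gamma$ has a Pfaffian orientation (one for which all perfect matchings have the same sign in the Pfaffian) such that $$Z(\widehat G)=\operatorname{PM}(\Gamma)=c\cdot\operatorname{Pf}(K),$$ where $K$ is the skew-symmetric weighted adjacency matrix of $\Gamma$ under this orientation (weights of parallel edges are added with the signs of their orientations). -/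

import Mathlib

open scoped BigOperators

noncomputable section

namespace Quon

/-! ## String diagrams on a sphere

A four-valent coupon has corners `0, 1, 2, 3` in counterclockwise order (bottom left, bottom right,
top right, top left).  It is a linear combination of its two non-crossing resolutions:
`true` is the cap over the cup (corner pairs `01`, `23`), `false` is the pair of vertical strings
(corner pairs `03`, `12`). -/

/-- The corner joined to a given corner in a resolution. -/
def resolve : Bool → Fin 4 → Fin 4
  | true => ![1, 0, 3, 2]
  | false => ![3, 2, 1, 0]

/-- Two vertical strings. -/
def vertical : Bool → ℂ := fun b => if b then 0 else 1

/-- A cap over a cup. -/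
def horizontal : Bool → ℂ := fun b => if b then 1 else 0

/-- Two vertical strings joined by a wire, i.e. carrying a pair of charges:
`√2 · horizontal - vertical`. -/
def chargedVertical : Bool → ℂ := fun b => (√2 : ℝ) * horizontal b - vertical b

/-- A cap and a cup joined by a wire: `√2 · vertical - horizontal`. -/
def chargedHorizontal : Bool → ℂ := fun b => (√2 : ℝ) * vertical b - horizontal b

/-- The crossing with parameter `α` written in its left (equivalently right) region, the one between
the corners `0` and `3`. -/
def crossing (α : ℂ) : Bool → ℂ :=
  fun b => 1 / (√2 : ℝ) * horizontal b + α / (√2 : ℝ) * chargedHorizontal b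

/-- The partition function of a ball whose boundary sphere carries the strings `strings` (joining
corners in pairs) and the coupons `coef`: resolve every coupon and give the value `√2 ^ m` to a
family of `m` disjoint circles. -/
def sphereValue {N : Type*} [Fintype N] [DecidableEq N]
    (strings : N × Fin 4 → N × Fin 4) (coef : N → Bool → ℂ) : ℂ :=
  ∑ s : N → Bool, (∏ n, coef n (s n)) *
    ((√2 : ℝ) : ℂ) ^ Nat.card
      (Quot fun x y : N × Fin 4 => y = strings x ∨ y = (x.1, resolve (s x.1) x.2))

/-- A ball with `k` time-boundary discs, each with four marked points, whose space boundary is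
decorated by strings and four-valent coupons.  `(Sum.inl j, i)` is the `i`-th marked point of the
`j`-th disc and `(Sum.inr c, i)` the `i`-th corner of the `c`-th coupon.  Discs and marked points are
numbered counterclockwise along the boundary of the planar projection. -/
structure Tangle (k : ℕ) where
  coupons : ℕ
  coef : Fin coupons → Bool → ℂ
  strings : (Fin k ⊕ Fin coupons) × Fin 4 → (Fin k ⊕ Fin coupons) × Fin 4
  strings_strings : ∀ x, strings (strings x) = x
  strings_ne : ∀ x, strings x ≠ x

/-- The orthonormal basis `|0⟩_X` (`false`), `|1⟩_X` (`true`) of the qubit space of a disc with four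
marked points: two nested arcs, respectively two nested arcs joined by a wire, times `1 / √2`. -/
def basisX (a : Bool) : Bool → ℂ :=
  fun b => 1 / (√2 : ℝ) * (if a then chargedVertical b else vertical b)

/-- The tensor of a decorated ball: its component at `a` is the partition function of the closed ball
obtained by capping the `j`-th disc with the basis vector `a j`. -/
def Tangle.tensor {k : ℕ} (T : Tangle k) (a : Fin k → Bool) : ℂ :=
  sphereValue T.strings (Sum.elim (fun j => basisX (a j)) T.coef)

/-! ## The elementary pieces -/

/-- Half of a ball decorated by two nested arcs: this is `√2 |0⟩_X`. -/
def zeroTangle : Tangle 1 where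
  coupons := 0
  coef := Fin.elim0
  strings := fun x => (x.1, x.2.rev)
  strings_strings := by decide
  strings_ne := by decide

/-- The gate `X`: a cylinder with four parallel strings and a pair of charges on the two leftmost
ones (the outer pink string and the inner black string next to it). -/
def flipTangle : Tangle 2 where
  coupons := 1
  coef := fun _ => chargedVertical
  strings
    | (.inl 0, i) => ![(.inr 0, 0), (.inr 0, 1), (.inl 1, 1), (.inl 1, 0)] i
    | (.inl 1, i) => ![(.inl 0, 3), (.inl 0, 2), (.inr 0, 2), (.inr 0, 3)] i
    | (.inr _, i) => ![(.inl 0, 0), (.inl 0, 1), (.inl 1, 2), (.inl 1, 3)] i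
  strings_strings := by decide
  strings_ne := by decide

/-- The crossing with parameter `α`: a cylinder with two outer (pink) parallel strings between which
two strings cross. -/
def crossTangle (α : ℂ) : Tangle 2 where
  coupons := 1
  coef := fun _ => crossing α
  strings
    | (.inl 0, i) => ![(.inl 1, 3), (.inr 0, 0), (.inr 0, 1), (.inl 1, 0)] i
    | (.inl 1, i) => ![(.inl 0, 3), (.inr 0, 2), (.inr 0, 3), (.inl 0, 0)] i
    | (.inr _, i) => ![(.inl 0, 1), (.inl 0, 2), (.inl 1, 1), (.inl 1, 2)] i
  strings_strings := by decide
  strings_ne := by decide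

/-- The `w` diagram: three discs, adjacent discs joined by an outer (pink) string, and three inner
strings from the disc `j` to the disc `j + 1` which cross pairwise.  The crossing `j` lies next to
the outer string between the discs `j` and `j + 1`, on whose side its parameter `exp (i π / 3)` is
written. -/
def wTangle : Tangle 3 where
  coupons := 3
  coef := fun _ => crossing (Complex.exp (Complex.I * Real.pi / 3))
  strings
    | (.inl j, i) => ![(.inl (j + 2), 3), (.inr (j + 2), 0), (.inr j, 3), (.inl (j + 1), 0)] i
    | (.inr j, i) => ![(.inl (j + 1), 1), (.inr (j + 1), 2), (.inr (j + 2), 1), (.inl j, 2)] i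
  strings_strings := by decide
  strings_ne := by decide

/-- The elementary pieces which the dictionary sends to vertices. -/
inductive Kind
  | zero
  | flip
  | w

/-- The number of discs of an elementary piece. -/
def Kind.arity : Kind → ℕ
  | .zero => 1
  | .flip => 2
  | .w => 3

/-- The decorated ball of an elementary piece. -/
def Kind.tangle : (k : Kind) → Tangle k.arity
  | .zero => zeroTangle
  | .flip => flipTangle
  | .w => wTangle

/-! ## Multigraphs, rotation systems, perfect matchings -/

/-- A multigraph (loops and parallel edges allowed) with vertices `V` and edges `E`.  The elements of
`E × Bool` are the half-edges and `ends` is the vertex to which a half-edge is attached. -/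
structure Multigraph (V E : Type*) where
  ends : E × Bool → V

namespace Multigraph

variable {V E : Type*}

/-- The degree of a vertex: the number of half-edges at it. -/
def degree (Γ : Multigraph V E) (v : V) : ℕ := Nat.card {d : E × Bool // Γ.ends d = v}

/-- The other half of the same edge. -/
def opposite : Equiv.Perm (E × Bool) := Equiv.prodCongr (Equiv.refl E) Equiv.boolNot

/-- A rotation system: a permutation of the half-edges whose cycles are the sets of half-edges at the
non-isolated vertices. -/
def IsRotation (Γ : Multigraph V E) (ρ : Equiv.Perm (E × Bool)) : Prop :=
  ∀ d d', ρ.SameCycle d d' ↔ Γ.ends d = Γ.ends d'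

/-- The number of connected components. -/
def components (Γ : Multigraph V E) : ℕ :=
  Nat.card (Quot fun u v => ∃ d : E × Bool, Γ.ends d = u ∧ Γ.ends (opposite d) = v)

/-- The number of faces of a rotation system, counted on one surface for each connected component
(the sphere carrying an isolated vertex has one face). -/
def faces (Γ : Multigraph V E) (ρ : Equiv.Perm (E × Bool)) : ℕ :=
  Nat.card (Quot fun d d' : E × Bool => d' = ρ (opposite d)) +
    Nat.card {v : V // ∀ d, Γ.ends d ≠ v}

/-- Every component of the surface of the rotation system is a sphere (Euler's formula). -/
def HasGenusZero (Γ : Multigraph V E) (ρ : Equiv.Perm (E × Bool)) : Prop :=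
  Nat.card V + Γ.faces ρ = Nat.card E + 2 * Γ.components

/-- A finite multigraph is planar if it has a rotation system of genus zero. -/
def IsPlanar (Γ : Multigraph V E) : Prop := ∃ ρ, Γ.IsRotation ρ ∧ Γ.HasGenusZero ρ

/-- A set of edges such that every vertex is an end of exactly one of them (so it has no loops). -/
def IsPerfectMatching (Γ : Multigraph V E) (M : Finset E) : Prop :=
  ∀ v, ∃! d : E × Bool, d.1 ∈ M ∧ Γ.ends d = v

open scoped Classical in
/-- The skew-symmetric weighted adjacency matrix under the orientation in which `e` points from
`ends (e, o e)` to `ends (e, !o e)`; parallel edges are added. -/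
def skewAdjacency [Fintype E] (Γ : Multigraph V E) (o : E → Bool) (wt : E → ℂ) : Matrix V V ℂ :=
  Matrix.of fun u v => ∑ e,
    ((if Γ.ends (e, o e) = u ∧ Γ.ends (e, !o e) = v then wt e else 0) -
      (if Γ.ends (e, o e) = v ∧ Γ.ends (e, !o e) = u then wt e else 0))

end Multigraph

/-- The Pfaffian of a skew-symmetric matrix. -/
def pfaffian {n : ℕ} (A : Matrix (Fin n) (Fin n) ℂ) : ℂ :=
  if Even n then
    1 / (2 ^ (n / 2) * (n / 2).factorial : ℂ) *
      ∑ σ : Equiv.Perm (Fin n), ((Equiv.Perm.sign σ : ℤ) : ℂ) *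
        ∏ i : Fin (n / 2), A (σ ⟨2 * i, by omega⟩) (σ ⟨2 * i + 1, by omega⟩)
  else 0

open scoped Classical in
/-- A Pfaffian orientation: all perfect matchings occur with the same sign in the Pfaffian of the
skew-symmetric adjacency matrix.  The sign of `M` is the Pfaffian of the matrix of `M` itself, and
`ν` is the numbering of the vertices. -/
def Multigraph.IsPfaffianOrientation {V E : Type*} [Fintype V] [Fintype E] (Γ : Multigraph V E)
    (ν : V ≃ Fin (Fintype.card V)) (o : E → Bool) : Prop :=
  ∀ M M' : Finset E, Γ.IsPerfectMatching M → Γ.IsPerfectMatching M' →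
    pfaffian ((Γ.skewAdjacency o fun e => if e ∈ M then 1 else 0).reindex ν ν) =
      pfaffian ((Γ.skewAdjacency o fun e => if e ∈ M' then 1 else 0).reindex ν ν)

/-- A multigraph with edge weights and a global coefficient. -/
structure WeightedGraph (V E : Type*) extends Multigraph V E where
  weight : E → ℂ
  coefficient : ℂ

open scoped Classical in
/-- The weighted perfect-matching count, including the global coefficient. -/
def WeightedGraph.perfectMatching {V E : Type*} [Fintype E] (Γ : WeightedGraph V E) : ℂ :=
  Γ.coefficient * ∑ M : Finset E with Γ.IsPerfectMatching M, ∏ e ∈ M, Γ.weight e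

/-! ## Standard forms -/

/-- A decorated handlebody glued from elementary pieces along their time-boundary discs: for each
`v : V` a piece `|0⟩`, `X` or `w`, for each `e : E` a chain of crossing cylinders with parameters
`crossings e` (possibly an empty chain), and every disc of every piece glued to one of the two ends
of one of the chains. -/
structure Network (V E : Type*) where
  kind : V → Kind
  crossings : E → List ℂ
  glue : (Σ v, Fin (kind v).arity) ≃ E × Bool

namespace Network

variable {V E : Type*}

/-- The multigraph whose vertices are the pieces and whose edges are the chains. -/
def toMultigraph (G : Network V E) : Multigraph V E where
  ends := fun d => (G.glue.symm d).1

/-- The rotation system given by the counterclockwise order of the discs of each piece in the planar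
projection. -/
def rotation (G : Network V E) : Equiv.Perm (E × Bool) :=
  G.glue.permCongr (Equiv.sigmaCongrRight fun v => finRotate (G.kind v).arity)

/-- The discs along which the handlebody is cut into balls: `n + 1` discs for a chain of `n`
crossings. -/
abbrev Disc (G : Network V E) : Type _ := Σ e : E, Fin ((G.crossings e).length + 1)

/-- The disc at one end of a chain. -/
def endDisc (G : Network V E) (d : E × Bool) : G.Disc :=
  ⟨d.1, if d.2 then Fin.last _ else 0⟩

/-- The partition function of the handlebody: cut along all discs (a sum over an orthonormal basis
of the qubit space of each disc) and evaluate the resulting balls. -/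
def partitionFunction [Fintype V] [Fintype E] [DecidableEq E] (G : Network V E) : ℂ :=
  ∑ x : G.Disc → Bool,
    (∏ v, (G.kind v).tangle.tensor fun i => x (G.endDisc (G.glue ⟨v, i⟩))) *
      ∏ e, ∏ i : Fin (G.crossings e).length,
        (crossTangle ((G.crossings e).get i)).tensor ![x ⟨e, i.castSucc⟩, x ⟨e, i.succ⟩]

end Network

/-- A genus-zero diagram in standard form: the pieces are arranged in the plane, and the parameters
of the crossings on the chains are non-zero. -/
structure StandardForm (V E : Type*) extends Network V E where
  crossings_ne_zero : ∀ e, ∀ α ∈ crossings e, α ≠ 0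
  genus_zero : toNetwork.toMultigraph.HasGenusZero toNetwork.rotation

/-- The scalar which the dictionary attaches to a piece. -/
def Kind.coefficient : Kind → ℂ
  | .zero => (√2 : ℝ)
  | .flip => 1
  | .w => (√3 : ℝ) / 2 * Complex.I

/-- The dictionary: the pieces `|0⟩`, `X` and `w` become `√2`, `1` and `(√3 / 2) i` times a vertex of
degree one, two and three, and a crossing with parameter `α` becomes `α` times an edge of weight
`1 / α`; edge segments in series form one edge, with the product of the weights. -/
def dictionary {V E : Type*} [Fintype V] [Fintype E] (G : StandardForm V E) :
    WeightedGraph V E where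
  toMultigraph := G.toMultigraph
  weight := fun e => ((G.crossings e).map fun α => 1 / α).prod
  coefficient := (∏ v, (G.kind v).coefficient) * ∏ e, (G.crossings e).prod

end Quon

end

/-! Partition function. In the X basis every piece is explicit. The tensors of the cap, of X and of
w are scalars times the indicator of "exactly one disc carries the label `false`"
(`Kind.tangle_tensor`), and a crossing is diagonal, with entries 1 on `false` and `α` on `true`
(`crossTangle_tensor`). After cutting, only labels constant along each chain survive, so one label
per edge remains. The edges labelled `false` must form a perfect matching; an unmatched chain
contributes the product of its parameters and a matched one contributes 1, which is that product
times the weight of the edge. This is `dictionary_perfectMatching`.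

Planarity. The rotation system comes from the cyclic order of the discs, and its genus is part of
the hypothesis.

Pfaffian. Place all half-edges on a line, vertex by vertex in the order `ν`, and draw the edges as
chords. The sign of a perfect matching in the Pfaffian is governed by the parity of its chord
crossings and by the directions of its edges. Modulo two the crossing number is a quadratic function
on sets of edges (`crossingForm_add`). Genus zero makes every cycle a boundary of faces
(`HasGenusZero.exists_faceBoundary_eq`), and a computation around each vertex then shows that the
polar form vanishes on the cycle space (`Network.crossingPolar_order_eq_zero`). Two matchings differ
by a cycle, so on matchings the crossing number is a sum of edge terms `t e`
(`exists_crossingForm_eq_sum`). Reversing an edge changes the sign of the matchings through it, so a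
suitable orientation absorbs `t`; all matchings then have sign +1 (`pfaffian_skewAdjacency`). -/

noncomputable section

namespace Quon

/-! ### Counting the circles of a resolved diagram -/

/-- If `rep` selects a representative of each class of the equivalence relation generated by `r`,
the classes correspond to the fixed points of `rep`. -/
theorem card_quot_eq_card_fixed {X : Type*} [Fintype X] [DecidableEq X] (r : X → X → Prop)
    (rep : X → X) (hr : ∀ x y, r x y → rep x = rep y)
    (hrep : ∀ x, Relation.EqvGen r x (rep x)) :
    Nat.card (Quot r) = (Finset.univ.filter fun x => rep x = x).card := by
  have hE : ∀ x y, Relation.EqvGen r x y → rep x = rep y := by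
    intro x y h
    induction h with
    | rel x y h => exact hr x y h
    | refl => rfl
    | symm _ _ _ h => exact h.symm
    | trans _ _ _ _ _ h1 h2 => exact h1.trans h2
  let e : Quot r ≃ {x // rep x = x} :=
    { toFun := Quot.lift (fun x => ⟨rep x, (hE _ _ (hrep x)).symm⟩)
        fun x y h => Subtype.ext (hr x y h)
      invFun := fun x => Quot.mk r x.1
      left_inv := by
        rintro ⟨x⟩
        exact (Quot.eqvGen_sound (hrep x)).symm
      right_inv := fun x => Subtype.ext x.2 }
  rw [Nat.card_congr e, Nat.card_eq_fintype_card, Fintype.card_subtype]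

/-- The element of least code among `b`, and the points met when `A` and `B` are applied in turn
to `x`. -/
def leastOnWalk {X : Type*} (A B : X → X) (code : X → ℕ) : ℕ → X → X → X
  | 0, _, b => b
  | n + 1, x, b =>
    let y := A x
    let z := B y
    let b' := if code y < code b then y else b
    leastOnWalk A B code n z (if code z < code b' then z else b')

theorem eqvGen_leastOnWalk {X : Type*} (A B : X → X) (code : X → ℕ) (x₀ : X) (n : ℕ) (x b : X)
    (hx : Relation.EqvGen (fun x y => y = A x ∨ y = B x) x₀ x)
    (hb : Relation.EqvGen (fun x y => y = A x ∨ y = B x) x₀ b) :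
    Relation.EqvGen (fun x y => y = A x ∨ y = B x) x₀ (leastOnWalk A B code n x b) := by
  induction n generalizing x b with
  | zero => exact hb
  | succ n ih =>
    have hy := hx.trans _ _ _ (.rel x (A x) (.inl rfl))
    have hz := hy.trans _ _ _ (.rel (A x) (B (A x)) (.inr rfl))
    refine ih _ _ hz ?_
    split_ifs <;> assumption

/-- The canonical representative of the circle through a point. -/
def circleRep {N : Type*} (code : N → ℕ) (n : ℕ) (strings : N × Fin 4 → N × Fin 4) (s : N → Bool)
    (x : N × Fin 4) : N × Fin 4 :=
  leastOnWalk strings (fun x => (x.1, resolve (s x.1) x.2)) (fun x => 4 * code x.1 + x.2) n x x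

/-- The walk always stays on its circle, so invariance of the representative is all that must be
checked, and that is a finite computation. A step of the walk visits two points, so taking `n` to be
half the number of points is enough to go round any circle; below this gives 2, 6 and 12. -/
theorem card_quot_eq_card_circleRep {N : Type*} [Fintype N] [DecidableEq N] (code : N → ℕ) (n : ℕ)
    (strings : N × Fin 4 → N × Fin 4) (s : N → Bool)
    (h : ∀ x : N × Fin 4,
      circleRep code n strings s (strings x) = circleRep code n strings s x ∧
        circleRep code n strings s (x.1, resolve (s x.1) x.2) = circleRep code n strings s x) :
    Nat.card (Quot fun x y : N × Fin 4 => y = strings x ∨ y = (x.1, resolve (s x.1) x.2)) =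
      (Finset.univ.filter fun x => circleRep code n strings s x = x).card := by
  refine card_quot_eq_card_fixed _ _ ?_ fun x => eqvGen_leastOnWalk strings _ _ x _ x x
    (.refl _) (.refl _)
  rintro x y (rfl | rfl)
  · exact (h x).1.symm
  · exact (h x).2.symm

/-- A number for each disc and coupon. -/
def code {k c : ℕ} : Fin k ⊕ Fin c → ℕ := Sum.elim (fun j => j) (fun j => k + j)

theorem sum_one_zero {M : Type*} [AddCommMonoid M] (f : (Fin 1 ⊕ Fin 0 → Bool) → M) :
    ∑ s, f s = ∑ a, f (Sum.elim ![a] ![]) := by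
  refine (Fintype.sum_equiv
    { toFun := fun a => Sum.elim ![a] ![]
      invFun := fun s => s (.inl 0)
      left_inv := fun _ => rfl
      right_inv := fun s => ?_ } _ _ fun _ => rfl).symm
  ext (i | i) <;> fin_cases i
  rfl

theorem sum_two_one {M : Type*} [AddCommMonoid M] (f : (Fin 2 ⊕ Fin 1 → Bool) → M) :
    ∑ s, f s = ∑ a₀, ∑ a₁, ∑ b, f (Sum.elim ![a₀, a₁] ![b]) := by
  simp only [← Fintype.sum_prod_type']
  refine (Fintype.sum_equiv
    { toFun := fun p : (Bool × Bool) × Bool => Sum.elim ![p.1.1, p.1.2] ![p.2]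
      invFun := fun s => ((s (.inl 0), s (.inl 1)), s (.inr 0))
      left_inv := fun _ => rfl
      right_inv := fun s => ?_ } _ _ fun _ => rfl).symm
  ext (i | i) <;> fin_cases i <;> rfl

theorem sum_three_three {M : Type*} [AddCommMonoid M] (f : (Fin 3 ⊕ Fin 3 → Bool) → M) :
    ∑ s, f s = ∑ a₀, ∑ a₁, ∑ a₂, ∑ b₀, ∑ b₁, ∑ b₂, f (Sum.elim ![a₀, a₁, a₂] ![b₀, b₁, b₂]) := by
  simp only [← Fintype.sum_prod_type']
  refine (Fintype.sum_equiv
    { toFun := fun p : ((((Bool × Bool) × Bool) × Bool) × Bool) × Bool =>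
        Sum.elim ![p.1.1.1.1.1, p.1.1.1.1.2, p.1.1.1.2] ![p.1.1.2, p.1.2, p.2]
      invFun := fun s => (((((s (.inl 0), s (.inl 1)), s (.inl 2)), s (.inr 0)), s (.inr 1)),
        s (.inr 2))
      left_inv := fun _ => rfl
      right_inv := fun s => ?_ } _ _ fun _ => rfl).symm
  ext (i | i) <;> fin_cases i <;> rfl

/-! ### Tensors of the elementary pieces in the X basis -/

/-- `1 / √2`. -/
def invSqrtTwo : ℂ := 1 / ((√2 : ℝ) : ℂ)

theorem ofReal_sqrt_two_sq : ((√2 : ℝ) : ℂ) ^ 2 = 2 := by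
  rw [← Complex.ofReal_pow, Real.sq_sqrt (by norm_num)]
  norm_num

theorem ofReal_sqrt_two_ne_zero : ((√2 : ℝ) : ℂ) ≠ 0 := fun h => by
  have := ofReal_sqrt_two_sq
  simp [h] at this

theorem invSqrtTwo_sq : invSqrtTwo ^ 2 = 1 / 2 := by
  rw [invSqrtTwo, div_pow, ofReal_sqrt_two_sq, one_pow]

/-- With this substitution each state sum becomes a polynomial in `invSqrtTwo`, whose even powers
are rational. -/
theorem ofReal_sqrt_two_eq : ((√2 : ℝ) : ℂ) = 2 * invSqrtTwo := by
  rw [invSqrtTwo, ← ofReal_sqrt_two_sq]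
  field_simp [ofReal_sqrt_two_ne_zero]

theorem invSqrtTwo_pow : invSqrtTwo ^ 4 = 1 / 4 ∧ invSqrtTwo ^ 6 = 1 / 8 ∧
    invSqrtTwo ^ 8 = 1 / 16 ∧ invSqrtTwo ^ 10 = 1 / 32 := by
  have h (n : ℕ) : invSqrtTwo ^ (2 * n) = (1 / 2) ^ n := by rw [pow_mul, invSqrtTwo_sq]
  have h₂ := h 2
  have h₃ := h 3
  have h₄ := h 4
  have h₅ := h 5
  norm_num at h₂ h₃ h₄ h₅ ⊢
  exact ⟨h₂, h₃, h₄, h₅⟩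

theorem basisX_false_true : basisX false true = 0 := by simp [basisX, vertical]

theorem basisX_false_false : basisX false false = invSqrtTwo := by
  simp [basisX, vertical, invSqrtTwo]

theorem basisX_true_true : basisX true true = 1 := by
  simp [basisX, chargedVertical, horizontal, vertical]

theorem basisX_true_false : basisX true false = -invSqrtTwo := by
  simp [basisX, chargedVertical, horizontal, vertical, invSqrtTwo]

theorem crossing_true (α : ℂ) : crossing α true = (1 - α) * invSqrtTwo := by
  simp [crossing, chargedHorizontal, horizontal, vertical, invSqrtTwo]
  ring

theorem crossing_false (α : ℂ) : crossing α false = α := by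
  simp [crossing, chargedHorizontal, horizontal, vertical]

theorem chargedVertical_true : chargedVertical true = 2 * invSqrtTwo := by
  simp [chargedVertical, horizontal, vertical, ← ofReal_sqrt_two_eq]

theorem chargedVertical_false : chargedVertical false = -1 := by
  simp [chargedVertical, horizontal, vertical]

/-- The strings of the piece `|0⟩`. -/
def zeroStrings : (Fin 1 ⊕ Fin 0) × Fin 4 → (Fin 1 ⊕ Fin 0) × Fin 4 := fun x => (x.1, x.2.rev)

/-- The strings of the gate `X`. -/
def flipStrings : (Fin 2 ⊕ Fin 1) × Fin 4 → (Fin 2 ⊕ Fin 1) × Fin 4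
  | (.inl 0, i) => ![(.inr 0, 0), (.inr 0, 1), (.inl 1, 1), (.inl 1, 0)] i
  | (.inl 1, i) => ![(.inl 0, 3), (.inl 0, 2), (.inr 0, 2), (.inr 0, 3)] i
  | (.inr _, i) => ![(.inl 0, 0), (.inl 0, 1), (.inl 1, 2), (.inl 1, 3)] i

/-- The strings of the crossing cylinder. -/
def crossStrings : (Fin 2 ⊕ Fin 1) × Fin 4 → (Fin 2 ⊕ Fin 1) × Fin 4
  | (.inl 0, i) => ![(.inl 1, 3), (.inr 0, 0), (.inr 0, 1), (.inl 1, 0)] i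
  | (.inl 1, i) => ![(.inl 0, 3), (.inr 0, 2), (.inr 0, 3), (.inl 0, 0)] i
  | (.inr _, i) => ![(.inl 0, 1), (.inl 0, 2), (.inl 1, 1), (.inl 1, 2)] i

/-- The strings of the `w` diagram. -/
def wStrings : (Fin 3 ⊕ Fin 3) × Fin 4 → (Fin 3 ⊕ Fin 3) × Fin 4
  | (.inl j, i) => ![(.inl (j + 2), 3), (.inr (j + 2), 0), (.inr j, 3), (.inl (j + 1), 0)] i
  | (.inr j, i) => ![(.inl (j + 1), 1), (.inr (j + 1), 2), (.inr (j + 2), 1), (.inl j, 2)] i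

/-- The representative of the circle through a point of the resolved piece `|0⟩`. -/
def zeroRep (a : Bool) : (Fin 1 ⊕ Fin 0) × Fin 4 → (Fin 1 ⊕ Fin 0) × Fin 4 :=
  circleRep code 2 zeroStrings (Sum.elim ![a] ![])

/-- The representative of the circle through a point of the resolved gate `X`. -/
def flipRep (a₀ a₁ b : Bool) : (Fin 2 ⊕ Fin 1) × Fin 4 → (Fin 2 ⊕ Fin 1) × Fin 4 :=
  circleRep code 6 flipStrings (Sum.elim ![a₀, a₁] ![b])

/-- The representative of the circle through a point of the resolved crossing cylinder. -/
def crossRep (a₀ a₁ b : Bool) : (Fin 2 ⊕ Fin 1) × Fin 4 → (Fin 2 ⊕ Fin 1) × Fin 4 :=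
  circleRep code 6 crossStrings (Sum.elim ![a₀, a₁] ![b])

/-- The representative of the circle through a point of the resolved `w` diagram. -/
def wRep (a₀ a₁ a₂ b₀ b₁ b₂ : Bool) : (Fin 3 ⊕ Fin 3) × Fin 4 → (Fin 3 ⊕ Fin 3) × Fin 4 :=
  circleRep code 12 wStrings (Sum.elim ![a₀, a₁, a₂] ![b₀, b₁, b₂])

/-- The number of circles of the resolved gate `X`. -/
def flipCircles (a₀ a₁ b₀ : Bool) : ℕ :=
  bif a₀ then (bif a₁ then (bif b₀ then 3 else 2) else (bif b₀ then 2 else 1))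
  else (bif a₁ then (bif b₀ then 2 else 1) else (bif b₀ then 1 else 2))

/-- The number of circles of the resolved crossing cylinder. -/
def crossCircles (a₀ a₁ b₀ : Bool) : ℕ :=
  bif a₀ then (bif a₁ then (bif b₀ then 1 else 2) else (bif b₀ then 2 else 1))
  else (bif a₁ then (bif b₀ then 2 else 1) else (bif b₀ then 3 else 2))

/-- The number of circles of the resolved `w` diagram. -/
def wCircles (a₀ a₁ a₂ b₀ b₁ b₂ : Bool) : ℕ :=
  bif a₀ then
    bif a₁ then
      bif a₂ then
        bif b₀ then (bif b₁ then (bif b₂ then 1 else 2) else (bif b₂ then 2 else 3))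
        else (bif b₁ then (bif b₂ then 2 else 3) else (bif b₂ then 3 else 4))
      else
        bif b₀ then (bif b₁ then (bif b₂ then 2 else 1) else (bif b₂ then 1 else 2))
        else (bif b₁ then (bif b₂ then 3 else 2) else (bif b₂ then 2 else 3))
    else
      bif a₂ then
        bif b₀ then (bif b₁ then (bif b₂ then 2 else 3) else (bif b₂ then 1 else 2))
        else (bif b₁ then (bif b₂ then 1 else 2) else (bif b₂ then 2 else 3))
      else
        bif b₀ then (bif b₁ then (bif b₂ then 3 else 2) else (bif b₂ then 2 else 1))
        else (bif b₁ then (bif b₂ then 2 else 1) else (bif b₂ then 1 else 2))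
  else
    bif a₁ then
      bif a₂ then
        bif b₀ then (bif b₁ then (bif b₂ then 2 else 1) else (bif b₂ then 3 else 2))
        else (bif b₁ then (bif b₂ then 1 else 2) else (bif b₂ then 2 else 3))
      else
        bif b₀ then (bif b₁ then (bif b₂ then 3 else 2) else (bif b₂ then 2 else 1))
        else (bif b₁ then (bif b₂ then 2 else 1) else (bif b₂ then 1 else 2))
    else
      bif a₂ then
        bif b₀ then (bif b₁ then (bif b₂ then 3 else 2) else (bif b₂ then 2 else 1))
        else (bif b₁ then (bif b₂ then 2 else 1) else (bif b₂ then 1 else 2))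
      else
        bif b₀ then (bif b₁ then (bif b₂ then 4 else 3) else (bif b₂ then 3 else 2))
        else (bif b₁ then (bif b₂ then 3 else 2) else (bif b₂ then 2 else 3))

theorem zeroRep_spec : ∀ a : Bool, ∀ x : (Fin 1 ⊕ Fin 0) × Fin 4,
    zeroRep a (zeroStrings x) = zeroRep a x ∧
      zeroRep a (x.1, resolve (Sum.elim ![a] ![] x.1) x.2) = zeroRep a x := by
  decide +kernel

theorem flipRep_spec : ∀ a₀ a₁ b : Bool, ∀ x : (Fin 2 ⊕ Fin 1) × Fin 4,
    flipRep a₀ a₁ b (flipStrings x) = flipRep a₀ a₁ b x ∧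
      flipRep a₀ a₁ b (x.1, resolve (Sum.elim ![a₀, a₁] ![b] x.1) x.2) = flipRep a₀ a₁ b x := by
  decide +kernel

theorem crossRep_spec : ∀ a₀ a₁ b : Bool, ∀ x : (Fin 2 ⊕ Fin 1) × Fin 4,
    crossRep a₀ a₁ b (crossStrings x) = crossRep a₀ a₁ b x ∧
      crossRep a₀ a₁ b (x.1, resolve (Sum.elim ![a₀, a₁] ![b] x.1) x.2) = crossRep a₀ a₁ b x := by
  decide +kernel

theorem wRep_spec : ∀ a₀ a₁ a₂ b₀ b₁ b₂ : Bool, ∀ x : (Fin 3 ⊕ Fin 3) × Fin 4,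
    wRep a₀ a₁ a₂ b₀ b₁ b₂ (wStrings x) = wRep a₀ a₁ a₂ b₀ b₁ b₂ x ∧
      wRep a₀ a₁ a₂ b₀ b₁ b₂
        (x.1, resolve (Sum.elim ![a₀, a₁, a₂] ![b₀, b₁, b₂] x.1) x.2) =
          wRep a₀ a₁ a₂ b₀ b₁ b₂ x := by
  decide +kernel

theorem card_zeroRep : ∀ a : Bool,
    (Finset.univ.filter fun x => zeroRep a x = x).card = bif a then 1 else 2 := by
  decide +kernel

theorem card_flipRep : ∀ a₀ a₁ b : Bool,
    (Finset.univ.filter fun x => flipRep a₀ a₁ b x = x).card = flipCircles a₀ a₁ b := by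
  decide +kernel

theorem card_crossRep : ∀ a₀ a₁ b : Bool,
    (Finset.univ.filter fun x => crossRep a₀ a₁ b x = x).card = crossCircles a₀ a₁ b := by
  decide +kernel

theorem card_wRep : ∀ a₀ a₁ a₂ b₀ b₁ b₂ : Bool,
    (Finset.univ.filter fun x => wRep a₀ a₁ a₂ b₀ b₁ b₂ x = x).card =
      wCircles a₀ a₁ a₂ b₀ b₁ b₂ := by
  decide +kernel


theorem zeroTangle_tensor (a : Bool) :
    zeroTangle.tensor ![a] = if a then 0 else ((√2 : ℝ) : ℂ) := by
  have h : ∀ b : Bool, Nat.card (Quot fun x y : (Fin 1 ⊕ Fin 0) × Fin 4 =>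
      y = zeroStrings x ∨ y = (x.1, resolve (Sum.elim ![b] ![] x.1) x.2)) =
        bif b then 1 else 2 := fun b =>
    (card_quot_eq_card_circleRep code 2 zeroStrings _ (zeroRep_spec b)).trans (card_zeroRep b)
  change (∑ s : Fin 1 ⊕ Fin 0 → Bool, (∏ n, (Sum.elim (fun j => basisX (![a] j))
    (Fin.elim0 : Fin 0 → Bool → ℂ) n) (s n)) * ((√2 : ℝ) : ℂ) ^ Nat.card
      (Quot fun x y => y = zeroStrings x ∨ y = (x.1, resolve (s x.1) x.2))) = _
  simp only [sum_one_zero, h]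
  simp only [Fintype.prod_sum_type, Fin.prod_univ_one, Fin.prod_univ_zero, Fintype.sum_bool,
    Sum.elim_inl, Matrix.cons_val_zero, ofReal_sqrt_two_eq, cond_true, cond_false, mul_one, pow_one]
  cases a
  · simp only [basisX_false_true, basisX_false_false, mul_pow, invSqrtTwo_sq]
    norm_num
    ring
  · simp only [basisX_true_true, basisX_true_false, mul_pow, invSqrtTwo_sq]
    norm_num
    ring

theorem flipTangle_tensor (a₀ a₁ : Bool) :
    flipTangle.tensor ![a₀, a₁] = if a₀ = a₁ then 0 else 1 := by
  have h : ∀ b₀ b₁ c : Bool, Nat.card (Quot fun x y : (Fin 2 ⊕ Fin 1) × Fin 4 =>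
      y = flipStrings x ∨ y = (x.1, resolve (Sum.elim ![b₀, b₁] ![c] x.1) x.2)) =
        flipCircles b₀ b₁ c := fun b₀ b₁ c =>
    (card_quot_eq_card_circleRep code 6 flipStrings _ (flipRep_spec b₀ b₁ c)).trans
      (card_flipRep b₀ b₁ c)
  change (∑ s : Fin 2 ⊕ Fin 1 → Bool, (∏ n, (Sum.elim (fun j => basisX (![a₀, a₁] j))
    (fun _ => chargedVertical) n) (s n)) * ((√2 : ℝ) : ℂ) ^ Nat.card
      (Quot fun x y => y = flipStrings x ∨ y = (x.1, resolve (s x.1) x.2))) = _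
  simp only [sum_two_one, h]
  simp only [Fintype.prod_sum_type, Fin.prod_univ_one, Fin.prod_univ_two, Fintype.sum_bool,
    Sum.elim_inl, Sum.elim_inr, Matrix.cons_val_zero, Matrix.cons_val_one, ofReal_sqrt_two_eq,
    flipCircles, cond_true, cond_false, chargedVertical_true, chargedVertical_false]
  cases a₀ <;> cases a₁ <;>
  · simp only [basisX_false_true, basisX_false_false, basisX_true_true, basisX_true_false]
    ring_nf
    simp [invSqrtTwo_sq, invSqrtTwo_pow]
    try norm_num

/-- Diagonality is what lets a chain of crossings behave as a single edge. -/
theorem crossTangle_tensor (α : ℂ) (a₀ a₁ : Bool) :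
    (crossTangle α).tensor ![a₀, a₁] = if a₀ = a₁ then (if a₀ then α else 1) else 0 := by
  have h : ∀ b₀ b₁ c : Bool, Nat.card (Quot fun x y : (Fin 2 ⊕ Fin 1) × Fin 4 =>
      y = crossStrings x ∨ y = (x.1, resolve (Sum.elim ![b₀, b₁] ![c] x.1) x.2)) =
        crossCircles b₀ b₁ c := fun b₀ b₁ c =>
    (card_quot_eq_card_circleRep code 6 crossStrings _ (crossRep_spec b₀ b₁ c)).trans
      (card_crossRep b₀ b₁ c)
  change (∑ s : Fin 2 ⊕ Fin 1 → Bool, (∏ n, (Sum.elim (fun j => basisX (![a₀, a₁] j))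
    (fun _ => crossing α) n) (s n)) * ((√2 : ℝ) : ℂ) ^ Nat.card
      (Quot fun x y => y = crossStrings x ∨ y = (x.1, resolve (s x.1) x.2))) = _
  simp only [sum_two_one, h]
  simp only [Fintype.prod_sum_type, Fin.prod_univ_one, Fin.prod_univ_two, Fintype.sum_bool,
    Sum.elim_inl, Sum.elim_inr, Matrix.cons_val_zero, Matrix.cons_val_one, ofReal_sqrt_two_eq,
    crossCircles, cond_true, cond_false, crossing_true, crossing_false]
  cases a₀ <;> cases a₁ <;>
  · simp only [basisX_false_true, basisX_false_false, basisX_true_true, basisX_true_false]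
    ring_nf
    simp [invSqrtTwo_sq, invSqrtTwo_pow]
    try ring

theorem exp_pi_div_three :
    Complex.exp (Complex.I * Real.pi / 3) = 1 / 2 + (√3 : ℝ) / 2 * Complex.I := by
  rw [show Complex.I * (Real.pi : ℂ) / 3 = ((Real.pi / 3 : ℝ) : ℂ) * Complex.I by push_cast; ring,
    Complex.exp_mul_I, ← Complex.ofReal_cos, ← Complex.ofReal_sin, Real.cos_pi_div_three,
    Real.sin_pi_div_three]
  push_cast
  ring

theorem exp_pi_div_three_sq : Complex.exp (Complex.I * Real.pi / 3) ^ 2 =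
    Complex.exp (Complex.I * Real.pi / 3) - 1 := by
  rw [exp_pi_div_three]
  have h : ((√3 : ℝ) : ℂ) ^ 2 = 3 := by
    rw [← Complex.ofReal_pow, Real.sq_sqrt (by norm_num)]
    norm_num
  linear_combination (-1 / 4) * h + ((√3 : ℝ) : ℂ) ^ 2 / 4 * Complex.I_sq

theorem exp_pi_div_three_cube : Complex.exp (Complex.I * Real.pi / 3) ^ 3 = -1 := by
  linear_combination (Complex.exp (Complex.I * Real.pi / 3) + 1) * exp_pi_div_three_sq

/-- The coupon of the `w` diagram. -/
def wCoupon : Bool → ℂ := crossing (Complex.exp (Complex.I * Real.pi / 3))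

theorem wTangle_tensor_eq_sum (a : Fin 3 → Bool) : wTangle.tensor a =
    ∑ b₀, ∑ b₁, ∑ b₂, ∑ c₀, ∑ c₁, ∑ c₂, basisX (a 0) b₀ * basisX (a 1) b₁ * basisX (a 2) b₂ *
      (wCoupon c₀ * wCoupon c₁ * wCoupon c₂) * (2 * invSqrtTwo) ^ wCircles b₀ b₁ b₂ c₀ c₁ c₂ := by
  have h : ∀ b₀ b₁ b₂ c₀ c₁ c₂ : Bool, Nat.card (Quot fun x y : (Fin 3 ⊕ Fin 3) × Fin 4 =>
      y = wStrings x ∨ y = (x.1, resolve (Sum.elim ![b₀, b₁, b₂] ![c₀, c₁, c₂] x.1) x.2)) =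
        wCircles b₀ b₁ b₂ c₀ c₁ c₂ := fun b₀ b₁ b₂ c₀ c₁ c₂ =>
    (card_quot_eq_card_circleRep code 12 wStrings _ (wRep_spec b₀ b₁ b₂ c₀ c₁ c₂)).trans
      (card_wRep b₀ b₁ b₂ c₀ c₁ c₂)
  change (∑ s : Fin 3 ⊕ Fin 3 → Bool, (∏ n, (Sum.elim (fun j => basisX (a j))
    (fun _ => wCoupon) n) (s n)) * ((√2 : ℝ) : ℂ) ^ Nat.card
      (Quot fun x y => y = wStrings x ∨ y = (x.1, resolve (s x.1) x.2))) = _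
  simp only [sum_three_three, h]
  simp only [Fintype.prod_sum_type, Fin.prod_univ_three, Sum.elim_inl, Sum.elim_inr,
    Matrix.cons_val_zero, Matrix.cons_val_one, Matrix.cons_val, ofReal_sqrt_two_eq]

theorem wTangle_tensor (a₀ a₁ a₂ : Bool) : wTangle.tensor ![a₀, a₁, a₂] =
    if [a₀, a₁, a₂].count false = 1 then (√3 : ℝ) / 2 * Complex.I else 0 := by
  have h3 : ((√3 : ℝ) : ℂ) / 2 * Complex.I = Complex.exp (Complex.I * Real.pi / 3) - 1 / 2 := by
    rw [exp_pi_div_three]; ring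
  rw [wTangle_tensor_eq_sum, h3]
  simp only [Matrix.cons_val_zero, Matrix.cons_val_one, Matrix.cons_val]
  simp only [wCoupon, Fintype.sum_bool, wCircles, cond_true, cond_false, crossing_true,
    crossing_false]
  -- The three coupons make the state sum a cubic in `ω = exp (iπ/3)`; the relations for `ω²` and
  -- `ω³` reduce it to degree one, and the target value is `ω - 1/2`.
  have h₂ := exp_pi_div_three_sq
  have h₃ := exp_pi_div_three_cube
  generalize Complex.exp (Complex.I * Real.pi / 3) = ω at h₂ h₃
  obtain ⟨u₄, u₆, u₈, u₁₀⟩ := invSqrtTwo_pow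
  cases a₀ <;> cases a₁ <;> cases a₂ <;>
  · simp only [basisX_false_true, basisX_false_false, basisX_true_true, basisX_true_false,
      zero_mul, mul_zero, zero_add, add_zero]
    ring_nf
    simp only [u₄, u₆, u₈, u₁₀, h₂, h₃]
    simp
    try ring_nf


theorem existsUnique_fin_one_eq_false : ∀ a₀ : Bool,
    (∃! i, (![a₀] : Fin 1 → Bool) i = false) ↔ a₀ = false := by
  unfold ExistsUnique
  decide

theorem existsUnique_fin_two_eq_false : ∀ a₀ a₁ : Bool,
    (∃! i, (![a₀, a₁] : Fin 2 → Bool) i = false) ↔ a₀ ≠ a₁ := by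
  unfold ExistsUnique
  decide

theorem existsUnique_fin_three_eq_false : ∀ a₀ a₁ a₂ : Bool,
    (∃! i, (![a₀, a₁, a₂] : Fin 3 → Bool) i = false) ↔ [a₀, a₁, a₂].count false = 1 := by
  unfold ExistsUnique
  decide

-- The local matching condition: with `false` read as "this edge is in the matching", each piece
-- requires its vertex to be covered exactly once.
open scoped Classical in
theorem Kind.tangle_tensor (k : Kind) (a : Fin k.arity → Bool) :
    k.tangle.tensor a = if ∃! i, a i = false then k.coefficient else 0 := by
  cases k with
  | zero =>
    have ha : a = ![a (0 : Fin 1)] := by ext i; fin_cases i; rfl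
    generalize a (0 : Fin 1) = a₀ at ha
    subst ha
    have h := existsUnique_fin_one_eq_false a₀
    refine (zeroTangle_tensor a₀).trans ?_
    refine Eq.trans ?_ (if_congr h.symm rfl rfl)
    cases a₀ <;> simp [Kind.coefficient]
  | flip =>
    have ha : a = ![a (0 : Fin 2), a (1 : Fin 2)] := by ext i; fin_cases i <;> rfl
    generalize a (0 : Fin 2) = a₀ at ha
    generalize a (1 : Fin 2) = a₁ at ha
    subst ha
    have h := existsUnique_fin_two_eq_false a₀ a₁
    refine (flipTangle_tensor a₀ a₁).trans ?_
    refine Eq.trans ?_ (if_congr h.symm rfl rfl)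
    cases a₀ <;> cases a₁ <;> simp [Kind.coefficient]
  | w =>
    have ha : a = ![a (0 : Fin 3), a (1 : Fin 3), a (2 : Fin 3)] := by
      ext i; fin_cases i <;> rfl
    generalize a (0 : Fin 3) = a₀ at ha
    generalize a (1 : Fin 3) = a₁ at ha
    generalize a (2 : Fin 3) = a₂ at ha
    subst ha
    have h := existsUnique_fin_three_eq_false a₀ a₁ a₂
    exact (wTangle_tensor a₀ a₁ a₂).trans (if_congr h.symm rfl rfl)

/-! ### The partition function as a sum over perfect matchings -/

theorem eq_of_forall_castSucc_eq_succ {X : Type*} {n : ℕ} {x : Fin (n + 1) → X}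
    (h : ∀ i : Fin n, x i.castSucc = x i.succ) (i : Fin (n + 1)) : x i = x 0 := by
  induction i using Fin.induction with
  | zero => rfl
  | succ i ih => rw [← h i, ih]

theorem Kind.exists_finRotate_pow (k : Kind) (i j : Fin k.arity) :
    ∃ n : ℕ, (finRotate k.arity ^ n) i = j := by
  cases k with
  | zero => exact ⟨0, Subsingleton.elim (α := Fin 1) _ _⟩
  | flip =>
    have h : ∀ i j : Fin 2, ∃ n : Fin 2, (finRotate 2 ^ (n : ℕ)) i = j := by decide
    exact (h i j).imp' _ fun _ => id
  | w =>
    have h : ∀ i j : Fin 3, ∃ n : Fin 3, (finRotate 3 ^ (n : ℕ)) i = j := by decide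
    exact (h i j).imp' _ fun _ => id

namespace Network

variable {V E : Type*}

/-- A labelling that changes somewhere along a chain meets an off-diagonal entry of a crossing and
contributes 0. The other labellings are those pulled back from `E`. -/
theorem partitionFunction_eq_sum [Fintype V] [Fintype E] [DecidableEq E] (G : Network V E) :
    G.partitionFunction = ∑ y : E → Bool,
      (∏ v, (G.kind v).tangle.tensor fun i => y (G.glue ⟨v, i⟩).1) *
        ∏ e, if y e then (G.crossings e).prod else 1 := by
  symm
  refine Fintype.sum_of_injective (fun (y : E → Bool) (d : G.Disc) => y d.1) ?_ _ _ ?_ ?_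
  · intro y y' h
    ext e
    have := congrFun h ⟨e, 0⟩
    simpa using this
  · intro x hx
    have : ∃ e, ∃ i : Fin (G.crossings e).length, x ⟨e, i.castSucc⟩ ≠ x ⟨e, i.succ⟩ := by
      by_contra! hc
      refine hx ⟨fun e => x ⟨e, 0⟩, ?_⟩
      funext ⟨e, i⟩
      exact (eq_of_forall_castSucc_eq_succ (x := fun i => x ⟨e, i⟩) (hc e) i).symm
    obtain ⟨e, i, hi⟩ := this
    refine mul_eq_zero_of_right _ (Finset.prod_eq_zero (Finset.mem_univ e)
      (Finset.prod_eq_zero (Finset.mem_univ i) ?_))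
    rw [crossTangle_tensor, if_neg hi]
  · intro y
    congr 1
    refine Finset.prod_congr rfl fun e _ => ?_
    simp only [crossTangle_tensor, if_true]
    cases y e
    · simp
    · simp only [if_true]
      exact (Fin.prod_univ_getElem _).symm

theorem existsUnique_glue_iff (G : Network V E) (M : Finset E) (v : V) :
    (∃! i, (G.glue ⟨v, i⟩).1 ∈ M) ↔ ∃! d : E × Bool, d.1 ∈ M ∧ G.toMultigraph.ends d = v := by
  constructor
  · rintro ⟨i, hi, hu⟩
    refine ⟨G.glue ⟨v, i⟩, ⟨hi, by simp [toMultigraph]⟩, ?_⟩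
    rintro d ⟨hd, hv⟩
    obtain ⟨⟨w, j⟩, rfl⟩ := G.glue.surjective d
    simp only [toMultigraph, Equiv.symm_apply_apply] at hv
    subst hv
    rw [hu j hd]
  · rintro ⟨d, ⟨hd, hv⟩, hu⟩
    obtain ⟨⟨w, j⟩, rfl⟩ := G.glue.surjective d
    simp only [toMultigraph, Equiv.symm_apply_apply] at hv
    subst hv
    refine ⟨j, hd, fun i hi => ?_⟩
    have := G.glue.injective (hu (G.glue ⟨w, i⟩) ⟨hi, by simp [toMultigraph]⟩)
    simpa using this

/-- Transported through `glue`, the permutation preserves each piece and rotates its discs, which it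
does transitively. -/
theorem isRotation_rotation (G : Network V E) : G.toMultigraph.IsRotation G.rotation := by
  have hpow : ∀ (n : ℤ) (x : Σ v, Fin (G.kind v).arity), (G.rotation ^ n) (G.glue x) =
      G.glue ⟨x.1, (finRotate (G.kind x.1).arity ^ n) x.2⟩ := by
    intro n x
    have h : G.rotation ^ n = G.glue.permCongr (Equiv.sigmaCongrRight fun v =>
        (finRotate (G.kind v).arity ^ n : Equiv.Perm _)) := by
      change (G.glue.permCongrHom (Equiv.Perm.sigmaCongrRightHom _ fun v =>
        finRotate (G.kind v).arity)) ^ n = _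
      rw [← map_zpow, ← map_zpow]
      rfl
    rw [h]
    simp
  intro d d'
  obtain ⟨⟨v, i⟩, rfl⟩ := G.glue.surjective d
  obtain ⟨⟨w, j⟩, rfl⟩ := G.glue.surjective d'
  simp only [toMultigraph, Equiv.symm_apply_apply]
  constructor
  · rintro ⟨n, hn⟩
    rw [hpow] at hn
    exact congrArg Sigma.fst (G.glue.injective hn)
  · rintro rfl
    obtain ⟨n, hn⟩ := (G.kind v).exists_finRotate_pow i j
    refine ⟨n, ?_⟩
    rw [hpow, zpow_natCast, hn]

theorem degree_eq (G : Network V E) (v : V) : G.toMultigraph.degree v = (G.kind v).arity := by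
  have e : {d : E × Bool // G.toMultigraph.ends d = v} ≃ Fin (G.kind v).arity :=
    (G.glue.symm.subtypeEquiv (q := fun x => x.1 = v) fun _ => Iff.rfl).trans
      (Equiv.sigmaSubtype v)
  rw [Multigraph.degree, Nat.card_congr e, Nat.card_fin]

end Network

theorem Kind.arity_pos (k : Kind) : 0 < k.arity := by cases k <;> decide

theorem Kind.arity_le (k : Kind) : k.arity ≤ 3 := by cases k <;> decide

theorem dictionary_perfectMatching {V E : Type*} [Fintype V] [Fintype E] [DecidableEq E]
    (G : StandardForm V E) : (dictionary G).perfectMatching = G.partitionFunction := by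
  classical
  -- Matched edges receive the label `false`, that is `|0⟩_X`.
  let φ : Finset E ≃ (E → Bool) :=
    { toFun := fun M e => decide (e ∉ M)
      invFun := fun y => Finset.univ.filter fun e => y e = false
      left_inv := fun M => by ext; simp
      right_inv := fun y => by ext; simp }
  rw [Network.partitionFunction_eq_sum, ← φ.sum_comp, WeightedGraph.perfectMatching,
    Finset.mul_sum, Finset.sum_filter]
  refine Finset.sum_congr rfl fun M _ => ?_
  have hφ : ∀ e, φ M e = false ↔ e ∈ M := fun e => by simp [φ]
  have hφ' : ∀ e, φ M e = true ↔ e ∉ M := fun e => by simp [φ]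
  simp only [Kind.tangle_tensor, hφ, hφ', Network.existsUnique_glue_iff]
  by_cases hM : (dictionary G).IsPerfectMatching M
  · rw [if_pos hM, Finset.prod_congr rfl fun v _ => if_pos (show ∃! d : E × Bool,
      d.1 ∈ M ∧ G.toMultigraph.ends d = v from hM v)]
    simp only [dictionary]
    rw [mul_assoc]
    congr 1
    rw [← Finset.prod_mul_prod_compl M fun e => (G.crossings e).prod, ← Finset.prod_mul_prod_compl M
      fun e => if e ∉ M then (G.crossings e).prod else 1, mul_right_comm, ← Finset.prod_mul_distrib]
    congr 1
    -- On a matched edge the weight cancels the scalar of the chain, which needs all parameters to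
    -- be non-zero.
    · refine Finset.prod_congr rfl fun e he => ?_
      have h0 : (G.crossings e).prod ≠ 0 := fun h =>
        G.crossings_ne_zero e 0 (List.prod_eq_zero_iff.1 h) rfl
      rw [if_neg (by simpa using he)]
      have : ((G.crossings e).map fun α => 1 / α).prod = (G.crossings e).prod⁻¹ := by
        simp [List.prod_inv]
      rw [this, mul_inv_cancel₀ h0]
    · refine Finset.prod_congr rfl fun e he => ?_
      rw [if_pos (by simpa using he)]
  · rw [if_neg hM]
    symm
    obtain ⟨v, hv⟩ := not_forall.1 hM
    exact mul_eq_zero_of_left (Finset.prod_eq_zero (Finset.mem_univ v) (if_neg hv)) _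


/-! ### In genus zero, cycles modulo two are boundaries of faces -/

theorem Submodule.finrank_le_card_of_forall_comp_eq_zero {K X C : Type*} [Field K] [Fintype X]
    [Fintype C] (S : Submodule K (X → K)) (r : C → X)
    (h : ∀ g ∈ S, (∀ c, g (r c) = 0) → g = 0) : Module.finrank K S ≤ Fintype.card C := by
  rw [← Module.finrank_fintype_fun_eq_card K]
  refine LinearMap.finrank_le_finrank_of_injective
    (f := (LinearMap.funLeft K K r).comp S.subtype) ?_
  rw [← LinearMap.ker_eq_bot, LinearMap.ker_eq_bot']
  rintro ⟨g, hg⟩ h0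
  exact Subtype.ext (h g hg fun c => congrFun h0 c)

theorem ZMod.eq_of_add_eq_zero {a b : ZMod 2} (h : a + b = 0) : a = b := by
  rwa [CharTwo.add_eq_zero] at h

namespace Multigraph

variable {V E : Type*}

@[simp]
theorem opposite_opposite (d : E × Bool) : opposite (opposite d) = d := by
  rcases d with ⟨e, _ | _⟩ <;> rfl

/-- The set of edges with indicator function `Z` has even degree at every vertex. -/
def IsEven [Fintype E] [DecidableEq V] (Γ : Multigraph V E) (Z : E → ZMod 2) : Prop :=
  ∀ v, ∑ d, (if Γ.ends d = v then Z d.1 else 0) = 0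

/-- The incidence matrix modulo two. -/
def incidence [DecidableEq V] (Γ : Multigraph V E) : Matrix V E (ZMod 2) :=
  Matrix.of fun v e =>
    (if Γ.ends (e, true) = v then 1 else 0) + if Γ.ends (e, false) = v then 1 else 0

theorem incidence_mulVec [Fintype E] [DecidableEq V] (Γ : Multigraph V E) (Z : E → ZMod 2)
    (v : V) : Γ.incidence.mulVec Z v = ∑ d, (if Γ.ends d = v then Z d.1 else 0) := by
  simp [incidence, Matrix.mulVec, dotProduct, Fintype.sum_prod_type, add_mul]

theorem incidence_transpose_mulVec [Fintype V] [DecidableEq V] (Γ : Multigraph V E)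
    (g : V → ZMod 2) (e : E) :
    Γ.incidence.transpose.mulVec g e = g (Γ.ends (e, true)) + g (Γ.ends (e, false)) := by
  simp [incidence, Matrix.mulVec, dotProduct, add_mul, Finset.sum_add_distrib]

/-- The faces of a rotation system. -/
abbrev Face (ρ : Equiv.Perm (E × Bool)) : Type _ :=
  Quot fun d d' : E × Bool => d' = ρ (opposite d)

theorem Face.mk_rotation (ρ : Equiv.Perm (E × Bool)) (d : E × Bool) :
    (Quot.mk _ (ρ d) : Face ρ) = Quot.mk _ (opposite d) :=
  (Quot.sound (by simp)).symm

/-- The boundary of a set of faces, modulo two. -/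
def faceBoundary (ρ : Equiv.Perm (E × Bool)) : (Face ρ → ZMod 2) →ₗ[ZMod 2] (E → ZMod 2) where
  toFun g e := g (Quot.mk _ (e, true)) + g (Quot.mk _ (e, false))
  map_add' g g' := by ext e; simp only [Pi.add_apply]; ring
  map_smul' c g := by ext e; simp only [Pi.smul_apply, smul_eq_mul, RingHom.id_apply]; ring

theorem faceBoundary_apply_fst (ρ : Equiv.Perm (E × Bool)) (g : Face ρ → ZMod 2) (d : E × Bool) :
    faceBoundary ρ g d.1 = g (Quot.mk _ d) + g (Quot.mk _ (opposite d)) := by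
  obtain ⟨e, _ | _⟩ := d
  · exact add_comm _ _
  · rfl

theorem IsRotation.ends_apply {Γ : Multigraph V E} {ρ : Equiv.Perm (E × Bool)}
    (hρ : Γ.IsRotation ρ) (d : E × Bool) : Γ.ends (ρ d) = Γ.ends d :=
  ((hρ _ _).1 ⟨1, by simp⟩).symm

/-- The faces of `opposite d` and `ρ d` agree, and `ρ` permutes the half-edges at a vertex, so every
value of `g` there is counted twice. -/
theorem isEven_faceBoundary [Fintype E] [DecidableEq V] {Γ : Multigraph V E}
    {ρ : Equiv.Perm (E × Bool)} (hρ : Γ.IsRotation ρ) (g : Face ρ → ZMod 2) :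
    Γ.IsEven (faceBoundary ρ g) := by
  intro v
  have h : ∀ d : E × Bool, (if Γ.ends d = v then faceBoundary ρ g d.1 else 0) =
      (if Γ.ends d = v then g (Quot.mk _ d) else 0) +
        (if Γ.ends (ρ d) = v then g (Quot.mk _ (ρ d)) else 0) := by
    intro d
    rw [hρ.ends_apply, faceBoundary_apply_fst, Face.mk_rotation]
    split_ifs <;> simp
  rw [Finset.sum_congr rfl fun d _ => h d, Finset.sum_add_distrib,
    Equiv.sum_comp ρ fun d => if Γ.ends d = v then g (Quot.mk _ d) else 0, CharTwo.add_self_eq_zero]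

/-- The connected component of a vertex. -/
abbrev Component (Γ : Multigraph V E) : Type _ :=
  Quot fun u v => ∃ d : E × Bool, Γ.ends d = u ∧ Γ.ends (opposite d) = v

theorem eq_of_component_eq {Γ : Multigraph V E} {X : Type*} (g : V → X)
    (hg : ∀ d, g (Γ.ends d) = g (Γ.ends (opposite d))) {u v : V}
    (h : (Quot.mk _ u : Γ.Component) = Quot.mk _ v) : g u = g v := by
  have hlift : ∀ u v, (∃ d : E × Bool, Γ.ends d = u ∧ Γ.ends (opposite d) = v) → g u = g v := by
    rintro _ _ ⟨d, rfl, rfl⟩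
    exact hg d
  exact congrArg (Quot.lift g hlift) h

/-- This is the vanishing of the first homology modulo two, proved by counting dimensions:
boundaries are cycles, and Euler's formula forces the two spaces to have equal dimension. -/
theorem HasGenusZero.exists_faceBoundary_eq [Fintype V] [Fintype E] [DecidableEq V]
    {Γ : Multigraph V E} {ρ : Equiv.Perm (E × Bool)} (h0 : Γ.HasGenusZero ρ)
    (hρ : Γ.IsRotation ρ) (hV : ∀ v, ∃ d, Γ.ends d = v) {Z : E → ZMod 2} (hZ : Γ.IsEven Z) :
    ∃ g, faceBoundary ρ g = Z := by
  classical
  have : Finite (Face ρ) := Quot.finite _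
  have : Finite Γ.Component := Quot.finite _
  have := Fintype.ofFinite (Face ρ)
  have := Fintype.ofFinite Γ.Component
  have hF : Fintype.card V + Fintype.card (Face ρ) =
      Fintype.card E + 2 * Fintype.card Γ.Component := by
    have : Nat.card {v : V // ∀ d, Γ.ends d ≠ v} = 0 := by
      have : IsEmpty {v : V // ∀ d, Γ.ends d ≠ v} :=
        ⟨fun v => (hV v.1).elim fun d hd => v.2 d hd⟩
      exact Nat.card_of_isEmpty
    simpa only [HasGenusZero, faces, components, this, Nat.card_eq_fintype_card, add_zero] using h0
  -- A function in this kernel is constant on components, so one value per component determines it.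
  have hcut : Module.finrank (ZMod 2) (LinearMap.ker Γ.incidence.transpose.mulVecLin) ≤
      Fintype.card Γ.Component := by
    refine Submodule.finrank_le_card_of_forall_comp_eq_zero _ Quot.out fun g hg hr => ?_
    have hg' : ∀ d, g (Γ.ends d) = g (Γ.ends (opposite d)) := by
      rintro ⟨e, b⟩
      have := congrFun (LinearMap.mem_ker.1 hg) e
      rw [Matrix.mulVecLin_apply, incidence_transpose_mulVec] at this
      cases b
      · exact (ZMod.eq_of_add_eq_zero this).symm
      · exact ZMod.eq_of_add_eq_zero this
    ext v
    rw [← eq_of_component_eq g hg' (Quot.out_eq (Quot.mk _ v)), hr, Pi.zero_apply]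
  choose dart hdart using hV
  -- A set of faces without boundary is constant across edges, hence around vertices, hence on each
  -- component.
  have hface : Module.finrank (ZMod 2) (LinearMap.ker (faceBoundary ρ)) ≤
      Fintype.card Γ.Component := by
    refine Submodule.finrank_le_card_of_forall_comp_eq_zero _
      (fun c => Quot.mk _ (dart (Quot.out c))) fun g hg hr => ?_
    have hop : ∀ d, g (Quot.mk _ d) = g (Quot.mk _ (opposite d)) := by
      intro d
      have := congrFun (LinearMap.mem_ker.1 hg) d.1
      rw [faceBoundary_apply_fst] at this
      exact ZMod.eq_of_add_eq_zero this
    have hrot : ∀ d, g (Quot.mk _ (ρ d)) = g (Quot.mk _ d) := fun d => by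
      rw [Face.mk_rotation, hop d]
    have hends : ∀ d d', Γ.ends d = Γ.ends d' → g (Quot.mk _ d) = g (Quot.mk _ d') := by
      intro d d' h
      obtain ⟨n, hn⟩ := ((hρ d d').2 h).exists_nat_pow_eq
      rw [← hn]
      clear hn
      induction n with
      | zero => rfl
      | succ n ih => rw [pow_succ', Equiv.Perm.mul_apply, hrot, ← ih]
    have hg' : ∀ d, g (Quot.mk _ (dart (Γ.ends d))) =
        g (Quot.mk _ (dart (Γ.ends (opposite d)))) := fun d => by
      rw [hends _ d (hdart _), hends _ (opposite d) (hdart _), hop]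
    ext ⟨d⟩
    have := eq_of_component_eq (fun v => g (Quot.mk _ (dart v))) hg'
      (Quot.out_eq (Quot.mk _ (Γ.ends d)))
    rw [← hends _ d (hdart (Γ.ends d)), ← this, hr, Pi.zero_apply]
  have h1 := LinearMap.finrank_range_add_finrank_ker (faceBoundary ρ)
  have h2 := LinearMap.finrank_range_add_finrank_ker Γ.incidence.mulVecLin
  have h3 := LinearMap.finrank_range_add_finrank_ker Γ.incidence.transpose.mulVecLin
  have h4 := Γ.incidence.rank_transpose
  simp only [Matrix.rank] at h4
  simp only [Module.finrank_fintype_fun_eq_card] at h1 h2 h3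
  have hle : LinearMap.range (faceBoundary ρ) ≤ LinearMap.ker Γ.incidence.mulVecLin := by
    rintro _ ⟨g, rfl⟩
    rw [LinearMap.mem_ker]
    ext v
    rw [Matrix.mulVecLin_apply, incidence_mulVec]
    exact isEven_faceBoundary hρ g v
  -- With `V`, `E`, `F`, `C` the numbers of vertices, edges, faces and components, boundaries have
  -- dimension at least `F - C` and cycles at most `E - V + C`; these are equal because `V + F = E +
  -- 2C`.
  have heq := Submodule.eq_of_le_of_finrank_le hle (by omega)
  have hmem : Z ∈ LinearMap.ker Γ.incidence.mulVecLin := by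
    rw [LinearMap.mem_ker]
    ext v
    rw [Matrix.mulVecLin_apply, incidence_mulVec]
    exact hZ v
  rw [← heq] at hmem
  exact hmem


/-! ### Chord crossings modulo two as a quadratic function -/

/-- The number of pairs of a half-edge of `e` and a half-edge of `f` in the given order,
modulo two. -/
def crossingParity (L : E × Bool → E × Bool → ZMod 2) (e f : E) : ZMod 2 :=
  ∑ b, ∑ c, L (e, b) (f, c)

/-- Exchanging the edges flips all four comparisons, an even number. -/
theorem crossingParity_comm {L : E × Bool → E × Bool → ZMod 2}
    (hL : ∀ x y, x ≠ y → L x y + L y x = 1)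
    {e f : E} (h : e ≠ f) : crossingParity L e f = crossingParity L f e := by
  have h' : ∀ b c, L (e, b) (f, c) = 1 + L (f, c) (e, b) := by
    intro b c
    rw [← hL (f, c) (e, b) (by simp [h.symm]), add_right_comm, CharTwo.add_self_eq_zero, zero_add]
  simp only [crossingParity, Fintype.sum_bool, h']
  linear_combination 2 * (CharTwo.two_eq_zero (R := ZMod 2))

theorem crossingParity_self {L : E × Bool → E × Bool → ZMod 2}
    (hL : ∀ x y, x ≠ y → L x y + L y x = 1)
    (hL' : ∀ x, L x x = 0) (e : E) : crossingParity L e e = 1 := by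
  have := hL (e, true) (e, false) (by simp)
  simp only [crossingParity, Fintype.sum_bool, hL', zero_add, add_zero, this]

/-- The number of crossings of a family of chords, modulo two, as a quadratic function. -/
def crossingForm [Fintype E] [LinearOrder E] (L : E × Bool → E × Bool → ZMod 2) (S : E → ZMod 2) :
    ZMod 2 :=
  ∑ p : E × E with p.1 < p.2, S p.1 * S p.2 * crossingParity L p.1 p.2

/-- The polar form of `crossingForm`. -/
def crossingPolar [Fintype E] (L : E × Bool → E × Bool → ZMod 2) (S T : E → ZMod 2) : ZMod 2 :=
  ∑ x, ∑ y, S x.1 * T y.1 * L x y + ∑ e, S e * T e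

theorem crossingPolar_add_left [Fintype E] (L : E × Bool → E × Bool → ZMod 2)
    (S S' T : E → ZMod 2) :
    crossingPolar L (S + S') T = crossingPolar L S T + crossingPolar L S' T := by
  simp only [crossingPolar, Pi.add_apply, add_mul, Finset.sum_add_distrib]
  ring

/-- The double sum over half-edges collects `S e * T f` over all ordered pairs. Symmetry of the
parity turns its off-diagonal part into the mixed terms of the form. The diagonal, where the parity
is 1, gives `∑ S e * T e`, cancelled by the second summand of `crossingPolar`. -/
theorem crossingForm_add [Fintype E] [LinearOrder E] {L : E × Bool → E × Bool → ZMod 2}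
    (hL : ∀ x y, x ≠ y → L x y + L y x = 1) (hL' : ∀ x, L x x = 0) (S T : E → ZMod 2) :
    crossingForm L (S + T) = crossingForm L S + crossingForm L T + crossingPolar L S T := by
  have h1 : ∑ x, ∑ y, S x.1 * T y.1 * L x y =
      ∑ p : E × E, S p.1 * T p.2 * crossingParity L p.1 p.2 := by
    simp only [Fintype.sum_prod_type, crossingParity, Finset.mul_sum]
    refine Finset.sum_congr rfl fun e _ => ?_
    exact Finset.sum_comm
  have h2 : ∑ p : E × E, S p.1 * T p.2 * crossingParity L p.1 p.2 =
      ∑ p : E × E with p.1 < p.2, S p.1 * T p.2 * crossingParity L p.1 p.2 +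
      ∑ p : E × E with p.1 < p.2, T p.1 * S p.2 * crossingParity L p.1 p.2 +
        ∑ e, S e * T e := by
    have hsplit : ∀ F : E × E → ZMod 2, ∑ p, F p = ∑ p : E × E with p.1 < p.2, F p +
        ∑ p : E × E with p.1 < p.2, F p.swap + ∑ e, F (e, e) := by
      intro F
      rw [← Finset.sum_filter_add_sum_filter_not Finset.univ (fun p : E × E => p.1 < p.2),
        add_assoc]
      congr 1
      rw [← Finset.sum_filter_add_sum_filter_not _ (fun p : E × E => p.2 < p.1)]
      congr 1
      · refine Finset.sum_nbij' Prod.swap Prod.swap ?_ ?_ ?_ ?_ ?_ <;> simp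
        exact fun a b h => ⟨h.le, h⟩
      · refine Finset.sum_nbij' Prod.fst (fun e => (e, e)) ?_ ?_ ?_ ?_ ?_ <;> simp
        · exact fun a b h h' => le_antisymm h' h
        · intro a b h h'
          rw [le_antisymm h h']
    rw [hsplit]
    congr 1
    · congr 1
      refine Finset.sum_congr rfl fun p hp => ?_
      rw [Prod.fst_swap, Prod.snd_swap,
        crossingParity_comm hL (Finset.mem_filter.1 hp).2.ne', mul_comm (S p.2)]
    · simp only [crossingParity_self hL hL', mul_one]
  rw [crossingPolar, h1, h2, add_assoc (_ + _), CharTwo.add_self_eq_zero, add_zero]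
  simp only [crossingForm, ← Finset.sum_add_distrib, Pi.add_apply]
  exact Finset.sum_congr rfl fun p _ => by ring

/-- The indicator function of a set of edges. -/
def indicator [DecidableEq E] (M : Finset E) (e : E) : ZMod 2 := if e ∈ M then 1 else 0

theorem IsPerfectMatching.sum_indicator [Fintype E] [DecidableEq V] [DecidableEq E]
    {Γ : Multigraph V E} {M : Finset E} (hM : Γ.IsPerfectMatching M) (v : V) :
    ∑ d, (if Γ.ends d = v then indicator M d.1 else 0) = 1 := by
  obtain ⟨d, ⟨hd, hv⟩, hu⟩ := hM v
  rw [Finset.sum_eq_single d, if_pos hv, indicator, if_pos hd]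
  · intro d' _ hne
    by_contra hc
    refine hne (hu d' ⟨?_, ?_⟩)
    · by_contra hm
      simp [indicator, hm] at hc
    · by_contra hm
      simp [hm] at hc
  · simp

theorem IsPerfectMatching.isEven_add [Fintype E] [DecidableEq V] [DecidableEq E]
    {Γ : Multigraph V E} {M M' : Finset E} (hM : Γ.IsPerfectMatching M)
    (hM' : Γ.IsPerfectMatching M') : Γ.IsEven (indicator M + indicator M') := by
  intro v
  have h := congrArg₂ (· + ·) (hM.sum_indicator v) (hM'.sum_indicator v)
  rw [CharTwo.add_self_eq_zero, ← Finset.sum_add_distrib] at h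
  refine Eq.trans ?_ h
  exact Finset.sum_congr rfl fun d _ => by split_ifs <;> simp

/-- The cycle space modulo two. -/
def cycleSpace [Fintype E] [DecidableEq V] (Γ : Multigraph V E) : AddSubgroup (E → ZMod 2) where
  carrier := {Z | Γ.IsEven Z}
  zero_mem' := fun v => by simp
  add_mem' {Z Z'} hZ hZ' v := by
    have h := congrArg₂ (· + ·) (hZ v) (hZ' v)
    rw [add_zero, ← Finset.sum_add_distrib] at h
    refine Eq.trans ?_ h
    exact Finset.sum_congr rfl fun d _ => by split_ifs <;> simp
  neg_mem' {Z} hZ v := by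
    refine Eq.trans ?_ (hZ v)
    exact Finset.sum_congr rfl fun d _ => by simp [CharTwo.neg_eq]

/-- Over the field with two elements additive maps on subgroups are linear maps on subspaces, and
these extend. -/
theorem exists_linear_of_additive_on {K : AddSubgroup (E → ZMod 2)} (ψ : (E → ZMod 2) → ZMod 2)
    (hψ : ∀ Z ∈ K, ∀ Z' ∈ K, ψ (Z + Z') = ψ Z + ψ Z') :
    ∃ ω : (E → ZMod 2) →ₗ[ZMod 2] ZMod 2, ∀ Z ∈ K, ω Z = ψ Z := by
  let K' : Submodule (ZMod 2) (E → ZMod 2) := AddSubgroup.toZModSubmodule 2 K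
  let f : K' →+ ZMod 2 := AddMonoidHom.mk' (fun Z => ψ Z) fun Z Z' => hψ _ Z.2 _ Z'.2
  obtain ⟨ω, hω⟩ := LinearMap.exists_extend (f.toZModLinearMap 2)
  exact ⟨ω, fun Z hZ => LinearMap.congr_fun hω ⟨Z, hZ⟩⟩

theorem linear_indicator [Fintype E] [DecidableEq E] (ω : (E → ZMod 2) →ₗ[ZMod 2] ZMod 2)
    (M : Finset E) :
    ω (indicator M) = ∑ e ∈ M, ω (Pi.single e 1) := by
  rw [← map_sum]
  congr 1
  ext e
  simp [indicator, Finset.sum_apply, Pi.single_apply]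

/-- If the polar form of the number of crossings vanishes on the cycle space, then this number is
linear on perfect matchings. -/
theorem exists_crossingForm_eq_sum [Fintype E] [LinearOrder E] [DecidableEq V]
    (Γ : Multigraph V E) {L : E × Bool → E × Bool → ZMod 2}
    (hL : ∀ x y, x ≠ y → L x y + L y x = 1) (hL' : ∀ x, L x x = 0)
    (hpolar : ∀ Z Z', Γ.IsEven Z → Γ.IsEven Z' → crossingPolar L Z Z' = 0) :
    ∃ t : E → ZMod 2, ∀ M, Γ.IsPerfectMatching M →
      crossingForm L (indicator M) = ∑ e ∈ M, t e := by
  by_cases hex : ∃ M₀, Γ.IsPerfectMatching M₀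
  swap
  · exact ⟨0, fun M hM => (hex ⟨M, hM⟩).elim⟩
  obtain ⟨M₀, hM₀⟩ := hex
  rcases isEmpty_or_nonempty V with hV | ⟨⟨v₀⟩⟩
  · have : IsEmpty E := ⟨fun e => hV.elim (Γ.ends (e, true))⟩
    refine ⟨0, fun M _ => ?_⟩
    simp [crossingForm]
  -- Shifting by the reference matching `M₀` makes this function record how the crossing number
  -- changes from `M₀` to `M₀ + Z`; it is additive since the polar form vanishes on cycles.
  obtain ⟨ω, hω⟩ := exists_linear_of_additive_on (K := Γ.cycleSpace)
    (fun Z => crossingForm L Z + crossingPolar L Z (indicator M₀)) fun Z hZ Z' hZ' => by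
      rw [crossingForm_add hL hL', hpolar Z Z' hZ hZ', crossingPolar_add_left]
      ring
  have key : ∀ M, Γ.IsPerfectMatching M → crossingForm L (indicator M) =
      ω (indicator M) + (crossingForm L (indicator M₀) + ω (indicator M₀)) := by
    intro M hM
    have h1 : indicator M = indicator M + indicator M₀ + indicator M₀ := by
      ext e
      rw [Pi.add_apply, Pi.add_apply, add_assoc, CharTwo.add_self_eq_zero, add_zero]
    have h2 := hω _ (hM.isEven_add hM₀)
    rw [map_add] at h2
    conv_lhs => rw [h1]
    rw [crossingForm_add hL hL']
    linear_combination -h2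
  -- The constant of the affine formula `key` is charged to the edges at `v₀`, exactly one of which
  -- lies in each matching.
  refine ⟨fun e => ω (Pi.single e 1) + (crossingForm L (indicator M₀) + ω (indicator M₀)) *
    ∑ b, if Γ.ends (e, b) = v₀ then 1 else 0, fun M hM => ?_⟩
  rw [key M hM, linear_indicator, Finset.sum_add_distrib, ← Finset.mul_sum]
  have h1 := hM.sum_indicator v₀
  have h3 : ∑ e ∈ M, ∑ b, (if Γ.ends (e, b) = v₀ then 1 else 0) = (1 : ZMod 2) := by
    refine Eq.trans ?_ h1
    rw [Fintype.sum_prod_type, ← Finset.sum_subset (Finset.subset_univ M)]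
    · refine Finset.sum_congr rfl fun e he => Finset.sum_congr rfl fun b _ => ?_
      simp [indicator, he]
    · intro e _ he
      simp [indicator, he]
  rw [h3, mul_one, linear_indicator]

end Multigraph

/-! ### Vanishing of the polar form on the cycle space -/

theorem sum_lt_rotate_two (f z : Fin 2 → ZMod 2) (hz : ∑ i, z i = 0) :
    ∑ i, ∑ j, (f i + f (finRotate _ i)) * z j * (if i < j then 1 else 0) = ∑ j, f j * z j := by
  rw [Fin.sum_univ_two] at hz
  simp [Fin.sum_univ_two, ZMod.eq_of_add_eq_zero hz]
  ring

theorem sum_lt_rotate_three (f z : Fin 3 → ZMod 2) (hz : ∑ i, z i = 0) :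
    ∑ i, ∑ j, (f i + f (finRotate _ i)) * z j * (if i < j then 1 else 0) = ∑ j, f j * z j := by
  rw [Fin.sum_univ_three, add_assoc] at hz
  simp [Fin.sum_univ_three, ZMod.eq_of_add_eq_zero hz]
  linear_combination f 1 * z 2 * (CharTwo.two_eq_zero (R := ZMod 2))

/-- For fixed `j` the sum over `i < j` telescopes to `f 0 + f j`, and the terms `f 0 * z j` add up
to 0 because `∑ z = 0`. For the arities that occur the identity is checked directly. -/
theorem Kind.sum_lt_rotate (k : Kind) (f z : Fin k.arity → ZMod 2) (hz : ∑ i, z i = 0) :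
    ∑ i, ∑ j, (f i + f (finRotate _ i)) * z j * (if (i : ℕ) < j then 1 else 0) =
      ∑ j, f j * z j := by
  cases k with
  | zero =>
    have hz : z (0 : Fin 1) = 0 := (Fin.sum_univ_one z).symm.trans hz
    have h (j : Fin Kind.zero.arity) : z j = 0 :=
      (congrArg z (Subsingleton.elim (α := Fin 1) _ _)).trans hz
    simp [h]
  | flip => exact sum_lt_rotate_two f z hz
  | w => exact sum_lt_rotate_three f z hz

namespace Network

variable {V E : Type*}

theorem sum_glue [Fintype V] [Fintype E] {M : Type*} [AddCommMonoid M] (G : Network V E)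
    (F : E × Bool → M) : ∑ d, F d = ∑ v, ∑ i, F (G.glue ⟨v, i⟩) := by
  rw [← G.glue.sum_comp, Fintype.sum_sigma]

theorem sum_ends_eq [Fintype V] [Fintype E] [DecidableEq V] {M : Type*} [AddCommMonoid M]
    (G : Network V E) (F : E × Bool → M) (v : V) :
    ∑ d, (if G.toMultigraph.ends d = v then F d else 0) = ∑ i, F (G.glue ⟨v, i⟩) := by
  rw [G.sum_glue, Finset.sum_eq_single v]
  · simp [toMultigraph]
  · intro w _ hw
    simp [toMultigraph, hw]
  · simp

/-- The order of the discs: by the number of the piece, then by the number within the piece. -/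
def order [DecidableEq V] {n : ℕ} (G : Network V E) (ν : V ≃ Fin n) (x y : E × Bool) : ZMod 2 :=
  if (G.glue.symm x).1 = (G.glue.symm y).1 then
    if ((G.glue.symm x).2 : ℕ) < (G.glue.symm y).2 then 1 else 0
  else if ν (G.glue.symm x).1 < ν (G.glue.symm y).1 then 1 else 0

theorem order_glue [DecidableEq V] {n : ℕ} (G : Network V E) (ν : V ≃ Fin n)
    (v w : V) (i : Fin (G.kind v).arity) (j : Fin (G.kind w).arity) :
    G.order ν (G.glue ⟨v, i⟩) (G.glue ⟨w, j⟩) =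
      if v = w then if (i : ℕ) < j then 1 else 0 else if ν v < ν w then 1 else 0 := by
  unfold order
  rw [Equiv.symm_apply_apply, Equiv.symm_apply_apply]

theorem order_self [DecidableEq V] {n : ℕ} (G : Network V E) (ν : V ≃ Fin n) (x : E × Bool) :
    G.order ν x x = 0 := by simp [order]

theorem order_add_order [DecidableEq V] {n : ℕ} (G : Network V E) (ν : V ≃ Fin n) (x y : E × Bool)
    (h : x ≠ y) : G.order ν x y + G.order ν y x = 1 := by
  obtain ⟨⟨v, i⟩, rfl⟩ := G.glue.surjective x
  obtain ⟨⟨w, j⟩, rfl⟩ := G.glue.surjective y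
  rw [order_glue, order_glue]
  by_cases hvw : v = w
  · subst hvw
    have hij : i ≠ j := fun hij => h (by rw [hij])
    simp only [if_true, Fin.val_fin_lt]
    rcases hij.lt_or_gt with hlt | hlt
    · rw [if_pos hlt, if_neg hlt.asymm, add_zero]
    · rw [if_pos hlt, if_neg hlt.asymm, zero_add]
  · rw [if_neg hvw, if_neg (Ne.symm hvw)]
    rcases (ν.injective.ne hvw).lt_or_gt with hlt | hlt
    · rw [if_pos hlt, if_neg hlt.asymm, add_zero]
    · rw [if_pos hlt, if_neg hlt.asymm, zero_add]

theorem order_of_ends_ne [DecidableEq V] {n : ℕ} (G : Network V E) (ν : V ≃ Fin n) (x y : E × Bool)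
    (h : G.toMultigraph.ends x ≠ G.toMultigraph.ends y) :
    G.order ν x y = if ν (G.toMultigraph.ends x) < ν (G.toMultigraph.ends y) then 1 else 0 :=
  if_neg h

-- Write `Z` as the boundary of a set `g` of faces. Pairs of half-edges at different vertices
-- cancel, since their order depends only on the vertices and `Z` is even. Pairs at one vertex
-- telescope to `∑ g d * Z' d`; collecting the two halves of each edge gives `∑ Z e * Z' e`, the
-- other summand of the polar form.
open Multigraph in
theorem crossingPolar_order_eq_zero [Fintype V] [Fintype E] [DecidableEq V] {n : ℕ}
    (G : Network V E) (h0 : G.toMultigraph.HasGenusZero G.rotation) (ν : V ≃ Fin n)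
    {Z Z' : E → ZMod 2} (hZ : G.toMultigraph.IsEven Z) (hZ' : G.toMultigraph.IsEven Z') :
    crossingPolar (G.order ν) Z Z' = 0 := by
  obtain ⟨g, rfl⟩ := h0.exists_faceBoundary_eq G.isRotation_rotation
    (fun v => ⟨G.glue ⟨v, ⟨0, (G.kind v).arity_pos⟩⟩, by simp [toMultigraph]⟩) hZ
  have hev : ∀ v, ∑ i, faceBoundary G.rotation g (G.glue ⟨v, i⟩).1 = 0 := fun v => by
    rw [← G.sum_ends_eq (fun d => faceBoundary G.rotation g d.1) v]
    exact hZ v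
  have hev' : ∀ v, ∑ i, Z' (G.glue ⟨v, i⟩).1 = 0 := fun v => by
    rw [← G.sum_ends_eq (fun d => Z' d.1) v]
    exact hZ' v
  have hrot : ∀ v i, faceBoundary G.rotation g (G.glue ⟨v, i⟩).1 =
      g (Quot.mk _ (G.glue ⟨v, i⟩)) + g (Quot.mk _ (G.glue ⟨v, finRotate _ i⟩)) := by
    intro v i
    rw [faceBoundary_apply_fst, ← Face.mk_rotation]
    simp [rotation]
  have h1 : ∑ x, ∑ y, faceBoundary G.rotation g x.1 * Z' y.1 * G.order ν x y =
      ∑ d, g (Quot.mk _ d) * Z' d.1 := by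
    rw [G.sum_glue, G.sum_glue]
    refine Finset.sum_congr rfl fun v _ => ?_
    have hw : ∀ w, w ≠ v → ∑ i, ∑ j, faceBoundary G.rotation g (G.glue ⟨v, i⟩).1 *
        Z' (G.glue ⟨w, j⟩).1 * G.order ν (G.glue ⟨v, i⟩) (G.glue ⟨w, j⟩) = 0 := by
      intro w hw
      simp only [order_glue, if_neg hw.symm, mul_assoc]
      simp only [← Finset.mul_sum]
      rw [← Finset.sum_mul, hev, zero_mul]
    simp only [G.sum_glue fun y => _ * Z' y.1 * _]
    rw [Finset.sum_comm, Finset.sum_eq_single v (fun w _ h => hw w h) (by simp)]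
    rw [← (G.kind v).sum_lt_rotate (fun i => g (Quot.mk _ (G.glue ⟨v, i⟩)))
      (fun i => Z' (G.glue ⟨v, i⟩).1) (hev' v)]
    simp only [order_glue, if_true, hrot]
  rw [crossingPolar, h1, Fintype.sum_prod_type, ← Finset.sum_add_distrib]
  refine Finset.sum_eq_zero fun e _ => ?_
  rw [Fintype.sum_bool]
  change _ + (g (Quot.mk _ (e, true)) + g (Quot.mk _ (e, false))) * Z' e = 0
  rw [add_mul, CharTwo.add_self_eq_zero]

end Network

/-! ### Inversions, signs and the Pfaffian in even dimension -/

/-- The sign `(-1) ^ z`. -/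
def signOf (z : ZMod 2) : ℤˣ := if z = 0 then 1 else -1

theorem signOf_zero : signOf 0 = 1 := rfl

theorem signOf_add : ∀ a b : ZMod 2, signOf (a + b) = signOf a * signOf b := by decide

theorem signOf_sum {ι : Type*} (s : Finset ι) (f : ι → ZMod 2) :
    signOf (∑ i ∈ s, f i) = ∏ i ∈ s, signOf (f i) := by
  classical
  induction s using Finset.induction_on with
  | empty => rfl
  | insert i s hi ih => rw [Finset.sum_insert hi, Finset.prod_insert hi, signOf_add, ih]

theorem sign_eq_signOf {n : ℕ} (σ : Equiv.Perm (Fin n)) :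
    σ.sign = signOf (∑ p, ∑ q, if p < q then (if σ q < σ p then 1 else 0) else 0) := by
  rw [σ.sign_eq_prod_prod_Ioi, signOf_sum]
  refine Finset.prod_congr rfl fun p _ => ?_
  rw [← Finset.sum_filter, signOf_sum]
  refine Finset.prod_congr (by ext; simp) fun q hq => ?_
  have hne : σ p ≠ σ q := σ.injective.ne (Finset.mem_filter.1 hq).2.ne
  rcases hne.lt_or_gt with h | h
  · rw [if_pos h, if_neg h.asymm, signOf_zero]
  · rw [if_neg h.asymm, if_pos h]
    rfl

theorem finProdFinEquiv_lt_iff {m : ℕ} (i j : Fin m) (b c : Fin 2) :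
    finProdFinEquiv (i, b) < finProdFinEquiv (j, c) ↔ i < j ∨ i = j ∧ b < c := by
  simp only [Fin.lt_def, Fin.ext_iff, finProdFinEquiv_apply_val]
  omega

/-- Positions come in consecutive blocks of two, one per Pfaffian factor: pairs inside a block will
give edge directions, pairs between blocks chord crossings. -/
theorem sum_finProd_lt {m : ℕ} (F : Fin (m * 2) → Fin (m * 2) → ZMod 2) :
    ∑ p, ∑ q, (if p < q then F p q else 0) =
      ∑ i, F (finProdFinEquiv (i, 0)) (finProdFinEquiv (i, 1)) +
        ∑ x : Fin m × Fin m with x.1 < x.2,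
          ∑ b, ∑ c, F (finProdFinEquiv (x.1, b)) (finProdFinEquiv (x.2, c)) := by
  rw [← finProdFinEquiv.sum_comp, Finset.sum_filter, Fintype.sum_prod_type, Fintype.sum_prod_type,
    ← Finset.sum_add_distrib]
  refine Finset.sum_congr rfl fun i _ => ?_
  have h : ∀ b, ∑ q, (if finProdFinEquiv (i, b) < q then F (finProdFinEquiv (i, b)) q else 0) =
      ∑ j, ∑ c, if i < j ∨ i = j ∧ b < c then
        F (finProdFinEquiv (i, b)) (finProdFinEquiv (j, c)) else 0 := by
    intro b
    rw [← finProdFinEquiv.sum_comp, Fintype.sum_prod_type]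
    simp only [finProdFinEquiv_lt_iff]
  rw [Finset.sum_congr rfl fun b _ => h b, Finset.sum_comm]
  have hi : F (finProdFinEquiv (i, 0)) (finProdFinEquiv (i, 1)) = ∑ j, if i = j then
      F (finProdFinEquiv (i, 0)) (finProdFinEquiv (j, 1)) else 0 := by simp
  rw [hi, ← Finset.sum_add_distrib]
  refine Finset.sum_congr rfl fun j _ => ?_
  rcases lt_trichotomy i j with hij | rfl | hij
  · simp [hij, hij.ne]
  · simp [Fin.sum_univ_two]
  · simp [hij.asymm, hij.ne']

/-- A sum of a symmetric function over unordered pairs does not depend on the order used to select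
representatives of the pairs. -/
theorem sum_lt_eq_sum_lt {ι κ M : Type*} [Fintype ι] [LinearOrder ι] [LinearOrder κ]
    [AddCommMonoid M] (τ : ι → κ) (hτ : Function.Injective τ) (c : ι → ι → M)
    (hc : ∀ i j, i ≠ j → c i j = c j i) :
    ∑ x : ι × ι with x.1 < x.2, c x.1 x.2 = ∑ x : ι × ι with τ x.1 < τ x.2, c x.1 x.2 := by
  refine Finset.sum_nbij' (fun x => if τ x.1 < τ x.2 then x else x.swap)
    (fun x => if x.1 < x.2 then x else x.swap) ?_ ?_ ?_ ?_ ?_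
  · rintro ⟨i, j⟩ h
    have h : i < j := by simpa using h
    rcases (hτ.ne h.ne).lt_or_gt with h' | h' <;> simp [h', h'.asymm]
  · rintro ⟨i, j⟩ h
    have h : τ i < τ j := by simpa using h
    rcases (ne_of_apply_ne τ h.ne).lt_or_gt with h' | h' <;> simp [h', h'.asymm]
  · rintro ⟨i, j⟩ h
    have h : i < j := by simpa using h
    rcases (hτ.ne h.ne).lt_or_gt with h' | h' <;> simp [h, h', h'.asymm, h.asymm]
  · rintro ⟨i, j⟩ h
    have h : τ i < τ j := by simpa using h
    rcases (ne_of_apply_ne τ h.ne).lt_or_gt with h' | h' <;> simp [h, h', h'.asymm, h.asymm]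
  · rintro ⟨i, j⟩ h
    have h : i < j := by simpa using h
    rcases (hτ.ne h.ne).lt_or_gt with h' | h'
    · simp [h']
    · simp [h'.asymm, hc i j h.ne]

theorem pfaffian_of_not_even {n : ℕ} (hn : ¬ Even n) (A : Matrix (Fin n) (Fin n) ℂ) :
    pfaffian A = 0 := if_neg hn

theorem pfaffian_mul_two {m : ℕ} (A : Matrix (Fin (m * 2)) (Fin (m * 2)) ℂ) :
    pfaffian A = 1 / (2 ^ m * m.factorial : ℂ) *
      ∑ σ : Equiv.Perm (Fin (m * 2)), ((Equiv.Perm.sign σ : ℤ) : ℂ) *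
        ∏ i : Fin m, A (σ (finProdFinEquiv (i, 0))) (σ (finProdFinEquiv (i, 1))) := by
  have h : m * 2 / 2 = m := Nat.mul_div_cancel m two_pos
  rw [pfaffian, if_pos (even_two.mul_left m)]
  congr 1
  · rw [h]
  · refine Finset.sum_congr rfl fun σ _ => congrArg _ ?_
    refine Fintype.prod_equiv (finCongr h) _ _ fun i => ?_
    congr 2
    · ext; simp
    · ext; simp [add_comm]

/-! ### The Pfaffian as a signed sum over perfect matchings -/

namespace Multigraph

variable {V E : Type*}

/-- The sign of a half-edge under an orientation. -/
def dartSign (o : E → Bool) (d : E × Bool) : ZMod 2 := if d.2 = o d.1 then 0 else 1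

open scoped Classical in
theorem skewAdjacency_apply [Fintype E] (Γ : Multigraph V E) (o : E → Bool) (wt : E → ℂ)
    (u v : V) : Γ.skewAdjacency o wt u v =
      ∑ d, if Γ.ends d = u ∧ Γ.ends (opposite d) = v then
        ((signOf (dartSign o d) : ℤ) : ℂ) * wt d.1 else 0 := by
  rw [Fintype.sum_prod_type]
  simp only [skewAdjacency, Matrix.of_apply]
  refine Finset.sum_congr rfl fun e _ => ?_
  rw [Fintype.sum_bool]
  have h1 : ∀ b, opposite (e, b) = (e, !b) := fun _ => rfl
  simp only [h1, dartSign]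
  cases h : o e
  · simp only [Bool.not_false, Bool.not_true, and_comm (a := Γ.ends (e, false) = v), reduceCtorEq,
      if_true, if_false]
    split_ifs <;> simp [signOf]
  · simp only [Bool.not_false, Bool.not_true, and_comm (a := Γ.ends (e, true) = v), reduceCtorEq,
      if_true, if_false]
    split_ifs <;> simp [signOf]

theorem IsPerfectMatching.bijective {Γ : Multigraph V E} {M : Finset E}
    (hM : Γ.IsPerfectMatching M) :
    Function.Bijective fun x : M × Bool => Γ.ends (x.1.1, x.2) := by
  constructor
  · rintro ⟨e, b⟩ ⟨f, c⟩ h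
    have := (hM (Γ.ends (e.1, b))).unique (y₁ := (e.1, b)) (y₂ := (f.1, c)) ⟨e.2, rfl⟩ ⟨f.2, h.symm⟩
    simp only [Prod.mk.injEq] at this
    exact Prod.ext (Subtype.ext this.1) this.2
  · intro v
    obtain ⟨⟨e, b⟩, ⟨he, hv⟩, -⟩ := hM v
    exact ⟨(⟨e, he⟩, b), hv⟩

theorem IsPerfectMatching.card_mul_two [Fintype V] {Γ : Multigraph V E} {M : Finset E}
    (hM : Γ.IsPerfectMatching M) : M.card * 2 = Fintype.card V := by
  rw [← Fintype.card_of_bijective hM.bijective]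
  simp

/-- The vertices met by a list of half-edges and their opposites. -/
def listEnds (Γ : Multigraph V E) {m : ℕ} (δ : Fin m → E × Bool) (p : Fin m × Fin 2) : V :=
  Γ.ends (if p.2 = 0 then δ p.1 else opposite (δ p.1))

/-- The half-edge lists that contribute to the Pfaffian are perfect matchings with numbered edges
and a chosen half of each edge; `listEnds` being injective excludes loops and repeated edges. -/
theorem exists_matching_of_bijective (Γ : Multigraph V E) {m : ℕ} {δ : Fin m → E × Bool}
    (hδ : Function.Bijective (Γ.listEnds δ)) :
    ∃ M : Finset E, Γ.IsPerfectMatching M ∧ ∃ τ : Fin m ≃ M, ∀ i, (τ i).1 = (δ i).1 := by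
  classical
  have hval : ∀ i, ∀ d : E × Bool, d.1 = (δ i).1 → ∃ b : Fin 2,
      d = if b = 0 then δ i else opposite (δ i) := by
    rintro i ⟨e, b⟩ rfl
    by_cases hb : b = (δ i).2
    · exact ⟨0, by rw [if_pos rfl, hb]⟩
    · refine ⟨1, ?_⟩
      rw [if_neg (by decide)]
      refine Prod.ext rfl ?_
      change b = !(δ i).2
      cases b <;> cases h : (δ i).2 <;> simp_all
  have hinj : Function.Injective fun i => (δ i).1 := by
    intro i j hij
    obtain ⟨b, hb⟩ := hval j (δ i) hij
    have := hδ.1 (a₁ := (i, 0)) (a₂ := (j, b)) (by simp only [listEnds, if_true, ← hb])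
    exact congrArg Prod.fst this
  refine ⟨Finset.univ.image fun i => (δ i).1, fun v => ?_, ?_⟩
  · obtain ⟨⟨i, b⟩, hv⟩ := hδ.2 v
    refine ⟨if b = 0 then δ i else opposite (δ i), ⟨?_, hv⟩, ?_⟩
    · refine Finset.mem_image.2 ⟨i, Finset.mem_univ i, ?_⟩
      split_ifs <;> rfl
    · rintro d ⟨hd, hdv⟩
      obtain ⟨j, -, hj⟩ := Finset.mem_image.1 hd
      obtain ⟨c, hc⟩ := hval j d hj.symm
      have := hδ.1 (a₁ := (i, b)) (a₂ := (j, c)) (by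
        rw [hv, ← hdv, listEnds, hc])
      obtain ⟨rfl, rfl⟩ := Prod.mk.injEq _ _ _ _ ▸ this
      exact hc
  · refine ⟨Equiv.ofBijective (fun i => ⟨(δ i).1, Finset.mem_image_of_mem _ (Finset.mem_univ i)⟩)
      ⟨fun i j h => hinj (congrArg Subtype.val h), fun e => ?_⟩, fun i => rfl⟩
    obtain ⟨i, -, hi⟩ := Finset.mem_image.1 e.2
    exact ⟨i, Subtype.ext hi⟩

/-- Pairs are selected by the order of `E` on one side and by the numbering `τ` on the other;
symmetry of the parity makes the choice immaterial. -/
theorem crossingForm_indicator [Fintype E] [LinearOrder E] {L : E × Bool → E × Bool → ZMod 2}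
    (hL : ∀ x y, x ≠ y → L x y + L y x = 1) {m : ℕ} {M : Finset E} (τ : Fin m ≃ M) :
    crossingForm L (indicator M) =
      ∑ x : Fin m × Fin m with x.1 < x.2, crossingParity L (τ x.2) (τ x.1) := by
  have hinj : Function.Injective fun i => (τ i).1 := Subtype.val_injective.comp τ.injective
  rw [sum_lt_eq_sum_lt (fun i => (τ i).1) hinj
    (fun i j => crossingParity L (τ j) (τ i))
    fun i j hij => crossingParity_comm hL (hinj.ne hij.symm)]
  have hsum : ∀ g : E → ZMod 2, ∑ e, indicator M e * g e = ∑ i, g (τ i) := by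
    intro g
    rw [τ.sum_comp fun e => g e.1, Finset.sum_coe_sort M g,
      ← Finset.sum_subset (Finset.subset_univ M)]
    · exact Finset.sum_congr rfl fun e he => by simp [indicator, he]
    · intro e _ he
      simp [indicator, he]
  rw [crossingForm, Finset.sum_filter, Finset.sum_filter, Fintype.sum_prod_type,
    Fintype.sum_prod_type]
  have h1 : ∀ e f, (if e < f then indicator M e * indicator M f * crossingParity L e f else 0) =
      indicator M e * (indicator M f * (if e < f then crossingParity L f e else 0)) := by
    intro e f
    split_ifs with h
    · rw [mul_assoc, crossingParity_comm hL h.ne]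
    · simp
  simp only [h1, ← Finset.mul_sum, hsum]


/-- The term of a list of half-edges in the Pfaffian has positive sign. -/
theorem sign_mul_prod_dartSign [Fintype E] [LinearOrder E] {m : ℕ} (Γ : Multigraph V E)
    (ν : V ≃ Fin (m * 2)) {L : E × Bool → E × Bool → ZMod 2}
    (hL : ∀ x y, x ≠ y → L x y + L y x = 1)
    (hLν : ∀ x y, Γ.ends x ≠ Γ.ends y → L x y = if ν (Γ.ends x) < ν (Γ.ends y) then 1 else 0)
    {t : E → ZMod 2} {o : E → Bool} (ho : ∀ e, L (e, !o e) (e, o e) = t e)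
    {M : Finset E} (hM : crossingForm L (indicator M) = ∑ e ∈ M, t e)
    {δ : Fin m → E × Bool} (τ : Fin m ≃ M) (hτ : ∀ i, (τ i).1 = (δ i).1)
    {σ : Equiv.Perm (Fin (m * 2))} (hσ : ∀ p, σ (finProdFinEquiv p) = ν (Γ.listEnds δ p)) :
    Equiv.Perm.sign σ * ∏ i, signOf (dartSign o (δ i)) = 1 := by
  have hends : ∀ p q, p ≠ q → Γ.listEnds δ p ≠ Γ.listEnds δ q := by
    intro p q hpq h
    refine hpq (finProdFinEquiv.injective (σ.injective ?_))
    rw [hσ, hσ, h]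
  have hF : ∀ p q, p ≠ q →
      (if σ (finProdFinEquiv q) < σ (finProdFinEquiv p) then (1 : ZMod 2) else 0) =
      L (if q.2 = 0 then δ q.1 else opposite (δ q.1))
        (if p.2 = 0 then δ p.1 else opposite (δ p.1)) := by
    intro p q hpq
    rw [hσ, hσ, hLν _ _ (hends q p hpq.symm)]
    rfl
  have hcross : ∀ d d' : E × Bool, ∑ b : Fin 2, ∑ c : Fin 2, L (if c = 0 then d' else opposite d')
      (if b = 0 then d else opposite d) = crossingParity L d'.1 d.1 := by
    rintro ⟨e, b⟩ ⟨f, c⟩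
    cases b <;> cases c <;>
      simp [Fin.sum_univ_two, crossingParity, opposite] <;> ring
  -- The contribution of one edge. For the half-edge chosen by `o` it vanishes by `ho`; passing to
  -- the opposite half changes both `L` and `dartSign` by 1.
  have hdart : ∀ d : E × Bool, L (opposite d) d + t d.1 + dartSign o d = 0 := by
    rintro ⟨e, b⟩
    by_cases hb : b = o e
    · subst hb
      change L (e, !o e) (e, o e) + t e + dartSign o (e, o e) = 0
      rw [ho, CharTwo.add_self_eq_zero, dartSign, if_pos rfl, add_zero]
    · have hb' : b = !o e := by cases b <;> cases h : o e <;> simp_all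
      subst hb'
      change L (e, !!o e) (e, !o e) + t e + dartSign o (e, !o e) = 0
      rw [Bool.not_not, ← ho, hL _ _ (by simp), dartSign, if_neg (by simp),
        CharTwo.add_self_eq_zero]
  -- Inversions inside blocks are compared in `h1`, those between blocks in `h2`, where their number
  -- is the crossing number of `M`, hence `∑ t`.
  rw [sign_eq_signOf, ← signOf_sum, ← signOf_add, sum_finProd_lt]
  have h1 : ∑ i,
      (if σ (finProdFinEquiv (i, 1)) < σ (finProdFinEquiv (i, 0)) then (1 : ZMod 2) else 0) =
      ∑ i, L (opposite (δ i)) (δ i) := by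
    refine Finset.sum_congr rfl fun i _ => ?_
    rw [hF _ _ (by simp)]
    simp
  have h2 : ∑ x : Fin m × Fin m with x.1 < x.2, ∑ b, ∑ c,
      (if σ (finProdFinEquiv (x.2, c)) < σ (finProdFinEquiv (x.1, b)) then (1 : ZMod 2) else 0) =
      ∑ i, t (δ i).1 := by
    have h3 : ∑ e ∈ M, t e = ∑ i, t (δ i).1 := by
      rw [← Finset.sum_coe_sort M t, ← τ.sum_comp]
      exact Finset.sum_congr rfl fun i _ => by rw [hτ]
    rw [← h3, ← hM, crossingForm_indicator hL τ]
    refine Finset.sum_congr rfl fun x hx => ?_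
    have hne : x.1 ≠ x.2 := (Finset.mem_filter.1 hx).2.ne
    rw [hτ, hτ, ← hcross]
    refine Finset.sum_congr rfl fun b _ => Finset.sum_congr rfl fun c _ => ?_
    exact hF (x.1, b) (x.2, c) fun h => hne (congrArg Prod.fst h)
  rw [h1, h2, ← Finset.sum_add_distrib, ← Finset.sum_add_distrib,
    Finset.sum_eq_zero fun i _ => hdart (δ i), signOf_zero]

-- Each matrix entry is a sum over half-edges, so the product over the factors expands over lists
-- `δ`; a permutation contributes to `δ` only if it enumerates the ends of `δ`.
open scoped Classical in
theorem pfaffian_skewAdjacency_eq_sum_lists [Fintype E] {m : ℕ} (Γ : Multigraph V E)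
    (ν : V ≃ Fin (m * 2)) (o : E → Bool) (wt : E → ℂ) :
    pfaffian ((Γ.skewAdjacency o wt).reindex ν ν) = 1 / (2 ^ m * m.factorial : ℂ) *
      ∑ δ : Fin m → E × Bool, (∑ σ : Equiv.Perm (Fin (m * 2)),
        if ∀ p, σ (finProdFinEquiv p) = ν (Γ.listEnds δ p) then
          ((Equiv.Perm.sign σ * ∏ i, signOf (dartSign o (δ i)) : ℤˣ) : ℂ) else 0) *
        ∏ i, wt (δ i).1 := by
  rw [pfaffian_mul_two]
  congr 1
  simp only [Finset.sum_mul]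
  rw [Finset.sum_comm]
  refine Finset.sum_congr rfl fun σ _ => ?_
  simp only [Matrix.reindex_apply, Matrix.submatrix_apply, skewAdjacency_apply]
  rw [Finset.prod_univ_sum, Fintype.piFinset_univ, Finset.mul_sum]
  refine Finset.sum_congr rfl fun δ _ => ?_
  have hiff : (∀ p, σ (finProdFinEquiv p) = ν (Γ.listEnds δ p)) ↔ ∀ i,
      Γ.ends (δ i) = ν.symm (σ (finProdFinEquiv (i, 0))) ∧
        Γ.ends (opposite (δ i)) = ν.symm (σ (finProdFinEquiv (i, 1))) := by
    simp only [Prod.forall, Fin.forall_fin_two, listEnds, if_true, Equiv.eq_symm_apply,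
      eq_comm (a := ν _)]
    simp
  by_cases h : ∀ p, σ (finProdFinEquiv p) = ν (Γ.listEnds δ p)
  · rw [if_pos h, Finset.prod_congr rfl fun i _ => if_pos (hiff.1 h i), Finset.prod_mul_distrib]
    push_cast
    ring
  · rw [if_neg h, zero_mul]
    obtain ⟨i, hi⟩ := not_forall.1 (mt hiff.2 h)
    rw [Finset.prod_eq_zero (Finset.mem_univ i) (if_neg hi), mul_zero]

open scoped Classical in
/-- The Pfaffian of the skew-symmetric adjacency matrix, for an orientation that corrects the
number of crossings of the perfect matchings, is the weighted number of perfect matchings. -/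
theorem pfaffian_skewAdjacency [Fintype V] [Fintype E] [LinearOrder E] {n : ℕ} (Γ : Multigraph V E)
    (ν : V ≃ Fin n) {L : E × Bool → E × Bool → ZMod 2}
    (hL : ∀ x y, x ≠ y → L x y + L y x = 1)
    (hLν : ∀ x y, Γ.ends x ≠ Γ.ends y → L x y = if ν (Γ.ends x) < ν (Γ.ends y) then 1 else 0)
    {t : E → ZMod 2} {o : E → Bool} (ho : ∀ e, L (e, !o e) (e, o e) = t e)
    (ht : ∀ M, Γ.IsPerfectMatching M → crossingForm L (indicator M) = ∑ e ∈ M, t e)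
    (wt : E → ℂ) : pfaffian ((Γ.skewAdjacency o wt).reindex ν ν) =
      ∑ M : Finset E with Γ.IsPerfectMatching M, ∏ e ∈ M, wt e := by
  have hcard : Fintype.card V = n := by rw [Fintype.card_congr ν, Fintype.card_fin]
  by_cases hn : Even n
  swap
  · rw [pfaffian_of_not_even hn, Finset.sum_eq_zero]
    intro M hM
    have := (Finset.mem_filter.1 hM).2.card_mul_two
    exact (hn (hcard ▸ this ▸ even_two.mul_left _)).elim
  obtain ⟨m, rfl⟩ : ∃ m, n = m * 2 := hn.exists_two_nsmul.imp fun m hm => by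
    rw [hm, smul_eq_mul, mul_comm]
  rw [pfaffian_skewAdjacency_eq_sum_lists]
  -- A matching of `m` edges arises from `m!` numberings and `2 ^ m` choices of halves, which
  -- cancels the normalisation of the Pfaffian.
  let I := Σ M : {M : Finset E // Γ.IsPerfectMatching M}, (Fin m ≃ M.1) × (Fin m → Bool)
  let list : I → Fin m → E × Bool := fun x i => ((x.2.1 i).1, x.2.2 i)
  have hlist : Function.Injective list := by
    rintro ⟨⟨M, hM⟩, τ, β⟩ ⟨⟨M', hM'⟩, τ', β'⟩ h
    have h1 : ∀ i, (τ i).1 = (τ' i).1 := fun i => congrArg Prod.fst (congrFun h i)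
    have h2 : ∀ i, β i = β' i := fun i => congrArg Prod.snd (congrFun h i)
    have hMM : M = M' := by
      ext e
      constructor
      · intro he
        obtain ⟨i, hi⟩ := τ.surjective ⟨e, he⟩
        have := h1 i
        rw [hi] at this
        exact (show e = _ from this) ▸ (τ' i).2
      · intro he
        obtain ⟨i, hi⟩ := τ'.surjective ⟨e, he⟩
        have := h1 i
        rw [hi] at this
        exact (show _ = e from this) ▸ (τ i).2
    subst hMM
    obtain rfl : β = β' := funext h2
    obtain rfl : τ = τ' := Equiv.ext fun i => Subtype.ext (h1 i)
    rfl
  have hsum := Fintype.sum_of_injective list hlist (fun x => ∏ e ∈ x.1.1, wt e)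
    (fun δ => (∑ σ : Equiv.Perm (Fin (m * 2)),
        if ∀ p, σ (finProdFinEquiv p) = ν (Γ.listEnds δ p) then
          ((Equiv.Perm.sign σ * ∏ i, signOf (dartSign o (δ i)) : ℤˣ) : ℂ) else 0) *
        ∏ i, wt (δ i).1) ?_ ?_
  · have hI : ∀ M : {M : Finset E // Γ.IsPerfectMatching M},
        ∑ _x : (Fin m ≃ M.1) × (Fin m → Bool), ∏ e ∈ M.1, wt e =
          (2 ^ m * m.factorial : ℂ) * ∏ e ∈ M.1, wt e := by
      intro M
      have hM : m = M.1.card := by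
        have := M.2.card_mul_two
        omega
      have e₀ : Fin m ≃ M.1 := (finCongr hM).trans M.1.equivFin.symm
      rw [Finset.sum_const, Finset.card_univ, Fintype.card_prod, Fintype.card_equiv e₀,
        Fintype.card_fin, Fintype.card_fun, Fintype.card_bool, Fintype.card_fin, nsmul_eq_mul,
        mul_comm m.factorial]
      push_cast
      rfl
    rw [← hsum, Fintype.sum_sigma, Finset.sum_congr rfl fun M _ => hI M, ← Finset.mul_sum,
      ← mul_assoc, one_div_mul_cancel (mul_ne_zero (pow_ne_zero _ two_ne_zero)
        (Nat.cast_ne_zero.2 m.factorial_ne_zero)), one_mul]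
    exact (Finset.sum_subtype (Finset.univ.filter fun M => Γ.IsPerfectMatching M)
      (fun M => by simp) fun M => ∏ e ∈ M, wt e).symm
  · intro δ hδ
    refine mul_eq_zero_of_left (Finset.sum_eq_zero fun σ _ => if_neg fun hσ => hδ ?_) _
    have hbij : Function.Bijective (Γ.listEnds δ) := by
      have : Γ.listEnds δ = ν.symm ∘ σ ∘ finProdFinEquiv := by
        ext p
        simp [hσ]
      rw [this]
      exact ν.symm.bijective.comp (σ.bijective.comp finProdFinEquiv.bijective)
    obtain ⟨M, hM, τ, hτ⟩ := Γ.exists_matching_of_bijective hbij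
    exact ⟨⟨⟨M, hM⟩, τ, fun i => (δ i).2⟩, funext fun i => Prod.ext (hτ i) rfl⟩
  · rintro ⟨⟨M, hM⟩, τ, β⟩
    let δ : Fin m → E × Bool := fun i => ((τ i).1, β i)
    have hbij : Function.Bijective (Γ.listEnds δ) := by
      let κ : Fin m × Fin 2 → M × Bool := fun p => (τ p.1, if p.2 = 0 then β p.1 else !β p.1)
      have hκ : Function.Bijective κ := by
        rw [Fintype.bijective_iff_injective_and_card]
        constructor
        · rintro ⟨i, b⟩ ⟨j, c⟩ h
          obtain rfl : i = j := τ.injective (congrArg Prod.fst h)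
          have := congrArg Prod.snd h
          fin_cases b <;> fin_cases c <;> simp [κ] at this ⊢
        · simp [← Fintype.card_congr τ]
      convert hM.bijective.comp hκ using 1
      ext ⟨i, b⟩
      fin_cases b <;> rfl
    -- The only permutation that survives for `δ`; its signed term is +1.
    let σ₀ : Equiv.Perm (Fin (m * 2)) :=
      finProdFinEquiv.symm.trans ((Equiv.ofBijective _ hbij).trans ν)
    have hσ₀ : ∀ p, σ₀ (finProdFinEquiv p) = ν (Γ.listEnds δ p) := fun p => by simp [σ₀]
    change ∏ e ∈ M, wt e = (∑ σ : Equiv.Perm (Fin (m * 2)),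
        if ∀ p, σ (finProdFinEquiv p) = ν (Γ.listEnds δ p) then
          ((Equiv.Perm.sign σ * ∏ i, signOf (dartSign o (δ i)) : ℤˣ) : ℂ) else 0) *
        ∏ i, wt (τ i).1
    rw [Finset.sum_eq_single σ₀, if_pos hσ₀,
      Γ.sign_mul_prod_dartSign ν hL hLν ho (ht M hM) τ (fun i => rfl) hσ₀,
      τ.prod_comp fun e => wt e.1, Finset.prod_coe_sort M wt]
    · simp
    · intro σ _ hne
      refine if_neg fun hσ => hne (Equiv.ext fun q => ?_)
      obtain ⟨p, rfl⟩ := finProdFinEquiv.surjective q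
      rw [hσ, hσ₀]
    · simp

end Multigraph

/-! ### Choice of the orientation and conclusion -/

/-- The half-edge orientation with prescribed order of the two ends of every edge. -/
theorem exists_orientation {E : Type*} {L : E × Bool → E × Bool → ZMod 2}
    (hL : ∀ x y, x ≠ y → L x y + L y x = 1) (t : E → ZMod 2) :
    ∃ o : E → Bool, ∀ e, L (e, !o e) (e, o e) = t e := by
  refine ⟨fun e => decide (L (e, false) (e, true) = t e), fun e => ?_⟩
  by_cases h : L (e, false) (e, true) = t e
  · simp [h]
  · have h' := hL (e, true) (e, false) (by simp)
    simp only [h, decide_false, Bool.not_false]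
    revert h h'
    generalize L (e, false) (e, true) = a
    generalize L (e, true) (e, false) = b
    generalize t e = c
    revert a b c
    decide

open scoped Classical in
/-- A network of genus zero has an orientation for which the Pfaffian of the skew-symmetric
adjacency matrix is the weighted number of perfect matchings, for all weights. -/
theorem Network.exists_pfaffian_eq {V E : Type*} [Fintype V] [Fintype E] (G : Network V E)
    (h0 : G.toMultigraph.HasGenusZero G.rotation) {n : ℕ} (ν : V ≃ Fin n) :
    ∃ o : E → Bool, ∀ wt : E → ℂ,
      pfaffian ((G.toMultigraph.skewAdjacency o wt).reindex ν ν) =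
        ∑ M : Finset E with G.toMultigraph.IsPerfectMatching M, ∏ e ∈ M, wt e := by
  -- Any order of the edges will do: it only selects one representative of each unordered pair.
  let _ : LinearOrder E := LinearOrder.lift' (Fintype.equivFin E) (Fintype.equivFin E).injective
  have hL := G.order_add_order ν
  obtain ⟨t, ht⟩ := G.toMultigraph.exists_crossingForm_eq_sum hL (G.order_self ν)
    fun Z Z' hZ hZ' => G.crossingPolar_order_eq_zero h0 ν hZ hZ'
  obtain ⟨o, ho⟩ := exists_orientation hL t
  exact ⟨o, fun wt =>
    G.toMultigraph.pfaffian_skewAdjacency ν hL (G.order_of_ends_ne ν) ho ht wt⟩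

-- A matching contained in another one equals it, so these weights isolate `M`. With the Pfaffian
-- formula for all weights, this shows that the sign of every matching is +1.
open scoped Classical in
theorem Multigraph.sum_prod_indicator {V E : Type*} [Fintype E] {Γ : Multigraph V E}
    {M : Finset E} (hM : Γ.IsPerfectMatching M) :
    ∑ M' : Finset E with Γ.IsPerfectMatching M', ∏ e ∈ M', (if e ∈ M then (1 : ℂ) else 0) = 1 := by
  rw [Finset.sum_eq_single M]
  · exact Finset.prod_eq_one fun e he => if_pos he
  · intro M' hM' hne
    by_contra hc
    have hsub : M' ⊆ M := fun e he => by
      by_contra he'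
      exact hc (Finset.prod_eq_zero he (if_neg he'))
    refine hne (hsub.antisymm fun e he => ?_)
    obtain ⟨d, ⟨hd, hv⟩, -⟩ := (Finset.mem_filter.1 hM').2 (Γ.ends (e, true))
    have := (hM (Γ.ends (e, true))).unique ⟨hsub hd, hv⟩ (y₂ := (e, true)) ⟨he, rfl⟩
    rwa [this] at hd
  · intro h
    exact (h (Finset.mem_filter.2 ⟨Finset.mem_univ M, hM⟩)).elim

end Quon
end
theorem mainTheorem9 {V E : Type*} [Fintype V] [Fintype E] [DecidableEq E]
    (G : Quon.StandardForm V E) :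
    (Quon.dictionary G).IsPlanar ∧
    (∀ v, (Quon.dictionary G).degree v ≤ 3) ∧
    (Quon.dictionary G).perfectMatching = G.partitionFunction ∧
    ∀ ν : V ≃ Fin (Fintype.card V), ∃ o : E → Bool,
      (Quon.dictionary G).IsPfaffianOrientation ν o ∧
      (Quon.dictionary G).coefficient *
        Quon.pfaffian (((Quon.dictionary G).skewAdjacency o (Quon.dictionary G).weight).reindex ν ν) =
          G.partitionFunction := by
  refine ⟨⟨G.rotation, G.isRotation_rotation, G.genus_zero⟩, fun v => ?_,
    Quon.dictionary_perfectMatching G, fun ν => ?_⟩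
  · exact (G.degree_eq v).trans_le (G.kind v).arity_le
  · obtain ⟨o, ho⟩ := G.exists_pfaffian_eq G.genus_zero ν
    refine ⟨o, fun M M' hM hM' => ?_, ?_⟩
    -- Both Pfaffians, taken with indicator weights, equal 1.
    · exact ((ho _).trans (Quon.Multigraph.sum_prod_indicator hM)).trans
        ((ho _).trans (Quon.Multigraph.sum_prod_indicator hM')).symm
    · rw [← Quon.dictionary_perfectMatching, Quon.WeightedGraph.perfectMatching]
      congr 1
      exact ho _
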